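/- \textbf{Setting.} Let $\mathcal S,\mathcal A,\mathcal B$ be finite sets, $\mathcal A,\mathcal B\neq\emptyset$, $d\in\mathbb N$, $\gamma\in(0,1)$, $\tau_\phi,\tau_\psi>0$. Consider a zero-sum Markov game with states $\mathcal S$, actions $\mathcal A$ (min-player) and $\mathcal B$ (max-player), reward $r_x(s,a,b)\in\mathbb R$ depending on $x\in\mathbb R^{d}$, transition kernel $\mathcal P(\cdot\mid s,a,b)$ and initial state distribution $\rho$. Both players use tabular softmax policies $\pi_\phi(a\mid s)=e^{\phi_{s,a}}/\sum_{a'}e^{\phi_{s,a'}}$, $\phi\in\mathbb R^{\mathcal S\times\mathcal A}$, and $\pi_\psi(b\mid s)=e^{\psi_{s,b}}/\sum_{b'}e^{\psi_{s,b'}}$, $\psi\in\mathbb R^{\mathcal S\times\mathcal B}$. With the Shannon entropy $H(p)=-\sum_i p_i\log p_i$ put $$J(x,\phi,\psi)=\mathbb E\Big[\sum_{t=0}^\infty\gamma^t\big(r_x(s_t,a_t,b_t)-\tau_\phi H(\pi_\phi(\cdot\mid s_t))+\tau_\psi H(\pi_\psi(\cdot\mid s_t))\big)\Big],$$ where $s_0\sim\rho$,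 $a_t\sim\pi_\phi(\cdot\mid s_t)$ and $b_t\sim\pi_\psi(\cdot\mid s_t)$ independently, and $s_{t+1}\sim\mathcal P(\cdot\mid s_t,a_t,b_t)$. The Nikaido--Isoda (NI) function is $$g(x,\phi,\psi)=\max_{\psi'}J(x,\phi,\psi')-\min_{\phi'}J(x,\phi',\psi),$$ with $\psi'$ and $\phi'$ ranging over all parameters. \textbf{Assumptions.} (1) $|r_x(s,a,b)|\le B_r$, and $x\mapsto r_x(s,a,b)$ is $C_r$-Lipschitz and differentiable with $L_r$-Lipschitz gradient, for all $s,a,b$; the parameters under consideration are $\phi\in\Phi$, $\psi\in\Psi$, where $\Phi,\Psi$ are sets of parameters such that, for a constant $\delta_\pi>0$, $\pi_\phi(a\mid s)\ge\delta_\pi$ and $\pi_\psi(b\mid s)\ge\delta_\pi$ for all $\phi\in\Phi$, $\psi\in\Psi$ and all $s,a,b$; and $\rho(s)\ge\delta_\rho>0$ for all $s$. (2) $J$ is twice differentiable in $(x,\phi,\psi)$, $C_J$-Lipschitz, $L_{J,1}$-smooth (its gradient is $L_{J,1}$-Lipschitz) and $L_{J,2}$-Hessian Lipschitz. All Lipschitz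 conditions in $(x,\phi,\psi)$ are with respect to $\|x-x'\|+\|\phi-\phi'\|+\|\psi-\psi'\|$. \textbf{Lemma.} There are constants $\mu_g,C_g,L_{g,1},L_{g,2}>0$, depending only on $\mathcal S,\mathcal A,\mathcal B,d,\gamma,\tau_\phi,\tau_\psi,B_r,C_r,L_r,\delta_\pi,\delta_\rho,C_J,L_{J,1},L_{J,2}$, such that under these assumptions the maxima and minima in the definition of $g$ are attained and: (i) $g$ is $\mu_g$-P{\L} in $(\phi,\psi)$: for every $x$ and all $\phi\in\Phi$, $\psi\in\Psi$, $$\|\nabla_{(\phi,\psi)}g(x,\phi,\psi)\|^2\ge 2\mu_g\Big(g(x,\phi,\psi)-\inf_{\phi',\psi'}g(x,\phi',\psi')\Big),$$ where the infimum is over all parameters and is finite; (ii) on the whole space of $(x,\phi,\psi)$, $g$ is twice differentiable, $C_g$-Lipschitz continuous, $L_{g,1}$-smooth and $L_{g,2}$-Hessian Lipschitz continuous. -/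

import Mathlib

open MeasureTheory ProbabilityTheory

noncomputable section

namespace MarkovGame

/-- The space of the upper-level variable `x`. -/
abbrev UpperVar (d : ℕ) : Type := EuclideanSpace ℝ (Fin d)

/-- Tabular policy parameters: one real number for every state-action pair. -/
abbrev Param (S A : Type*) : Type _ := EuclideanSpace ℝ (S × A)

/-- The parameters `θ = (φ, ψ)` of both players, with the Euclidean norm. -/
abbrev JointParam (S A B : Type*) : Type _ := WithLp 2 (Param S A × Param S B)

/-- All the variables `(x, φ, ψ) = (x, θ)`, with the Euclidean norm. -/
abbrev FullVar (d : ℕ) (S A B : Type*) : Type _ := WithLp 2 (UpperVar d × JointParam S A B)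

/-- The data of a parameterized two-player zero-sum Markov game: the reward `r_x(s,a,b)`, the
transition kernel `P(· | s,a,b)` and the initial state distribution. -/
structure Game (d : ℕ) (S A B : Type*) [Fintype S] where
  reward : UpperVar d → S → A → B → ℝ
  transition : S → A → B → stdSimplex ℝ S
  initial : stdSimplex ℝ S

/-! ### Policies and entropy -/

/-- The softmax distribution with logits `v`. -/
def softmax {A : Type*} [Fintype A] [Nonempty A] (v : A → ℝ) : stdSimplex ℝ A :=
  ⟨fun a => Real.exp (v a) / ∑ a', Real.exp (v a'), by
    have hpos : 0 < ∑ a', Real.exp (v a') :=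
      Finset.sum_pos (fun a' _ => Real.exp_pos _) Finset.univ_nonempty
    refine ⟨fun a => div_nonneg (Real.exp_pos _).le hpos.le, ?_⟩
    rw [← Finset.sum_div, div_self hpos.ne']⟩

/-- The tabular softmax policy `π_φ(· | s)`. -/
def policy {S A : Type*} [Fintype A] [Nonempty A] (φ : Param S A) (s : S) : stdSimplex ℝ A :=
  softmax fun a => φ (s, a)

/-- Shannon entropy `H(p) = - ∑ p(a) log p(a)`. -/
def entropy {A : Type*} [Fintype A] (p : stdSimplex ℝ A) : ℝ := ∑ a, Real.negMulLog (p.1 a)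

/-- The entropy regularizer `- τφ H(p) + τψ H(q)`. -/
def regularizer {A B : Type*} [Fintype A] [Fintype B] (τφ τψ : ℝ)
    (p : stdSimplex ℝ A) (q : stdSimplex ℝ B) : ℝ :=
  - τφ * entropy p + τψ * entropy q

/-! ### The law of the trajectory -/

/-- A point of the simplex as a probability mass function. -/
def toPMF {ι : Type*} [Fintype ι] (p : stdSimplex ℝ ι) : PMF ι :=
  PMF.ofFintype (fun i => ENNReal.ofReal (p.1 i)) (by
    rw [← ENNReal.ofReal_sum_of_nonneg fun i _ => p.2.1 i, p.2.2, ENNReal.ofReal_one])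

/-- What happens at one time step: the state and the actions of the two players. -/
structure Stage (S A B : Type*) where
  state : S
  actMin : A
  actMax : B

instance {S A B : Type*} : MeasurableSpace (Stage S A B) := ⊤

instance {S A B : Type*} : DiscreteMeasurableSpace (Stage S A B) := ⟨fun _ => trivial⟩

section Law

variable {d : ℕ} {S A B : Type*} [Fintype S] [Fintype A] [Fintype B]

/-- In state `s` the players draw their actions independently: `a ∼ p(· | s)`, `b ∼ q(· | s)`. -/
def stageLaw (p : S → stdSimplex ℝ A) (q : S → stdSimplex ℝ B) (s : S) : PMF (Stage S A B) :=
  (toPMF (p s)).bind fun a => (toPMF (q s)).bind fun b => PMF.pure ⟨s, a, b⟩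

/-- One step of the game: `s' ∼ P(· | s, a, b)`, then both players act in `s'`. -/
def stepKernel (M : Game d S A B) (p : S → stdSimplex ℝ A) (q : S → stdSimplex ℝ B) :
    Kernel (Stage S A B) (Stage S A B) where
  toFun z := ((toPMF (M.transition z.state z.actMin z.actMax)).bind (stageLaw p q)).toMeasure
  measurable' := Measurable.of_discrete

instance (M : Game d S A B) (p : S → stdSimplex ℝ A) (q : S → stdSimplex ℝ B) :
    IsMarkovKernel (stepKernel M p q) :=
  ⟨fun z => PMF.toMeasure.isProbabilityMeasure
    ((toPMF (M.transition z.state z.actMin z.actMax)).bind (stageLaw p q))⟩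

/-- The law of the next stage given the stages `0, …, n`; it depends on the last one only. -/
def historyKernel (M : Game d S A B) (p : S → stdSimplex ℝ A) (q : S → stdSimplex ℝ B) (n : ℕ) :
    Kernel (Π _ : Finset.Iic n, Stage S A B) (Stage S A B) :=
  (stepKernel M p q).comap (fun ω => ω ⟨n, Finset.mem_Iic.2 le_rfl⟩) (measurable_pi_apply _)

instance (M : Game d S A B) (p : S → stdSimplex ℝ A) (q : S → stdSimplex ℝ B) (n : ℕ) :
    IsMarkovKernel (historyKernel M p q n) := by
  unfold historyKernel; infer_instance

/-- The law of the trajectory `(s_t, a_t, b_t)_{t ≥ 0}` started in `s_0 = s`. -/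
def trajectoryLaw (M : Game d S A B) (p : S → stdSimplex ℝ A) (q : S → stdSimplex ℝ B) (s : S) :
    Measure (ℕ → Stage S A B) :=
  Kernel.trajMeasure (X := fun _ => Stage S A B) (stageLaw p q s).toMeasure (historyKernel M p q)

/-- The regularized state-value function. -/
def value (γ τφ τψ : ℝ) (M : Game d S A B) (x : UpperVar d)
    (p : S → stdSimplex ℝ A) (q : S → stdSimplex ℝ B) (s : S) : ℝ :=
  ∫ ω, ∑' t : ℕ, γ ^ t * (M.reward x (ω t).state (ω t).actMin (ω t).actMax
    + regularizer τφ τψ (p (ω t).state) (q (ω t).state)) ∂(trajectoryLaw M p q s)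

variable [Nonempty A] [Nonempty B]

/-- The lower-level objective `J(x, φ, ψ)`. -/
def objective (γ τφ τψ : ℝ) (M : Game d S A B)
    (x : UpperVar d) (φ : Param S A) (ψ : Param S B) : ℝ :=
  ∑ s, M.initial.1 s * value γ τφ τψ M x (policy φ) (policy ψ) s

/-- Every maximization and minimization problem in the Nikaido–Isoda function has a solution. -/
def BestResponsesExist (γ τφ τψ : ℝ) (M : Game d S A B) : Prop :=
  (∀ x φ, ∃ ψ, ∀ ψ', objective γ τφ τψ M x φ ψ' ≤ objective γ τφ τψ M x φ ψ) ∧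
  (∀ x ψ, ∃ φ, ∀ φ', objective γ τφ τψ M x φ ψ ≤ objective γ τφ τψ M x φ' ψ)

/-- The Nikaido–Isoda function `g(x,φ,ψ) = max_ψ' J(x,φ,ψ') - min_φ' J(x,φ',ψ)`. -/
def niFunction (γ τφ τψ : ℝ) (M : Game d S A B)
    (x : UpperVar d) (φ : Param S A) (ψ : Param S B) : ℝ :=
  (⨆ ψ' : Param S B, objective γ τφ τψ M x φ ψ') - ⨅ φ' : Param S A, objective γ τφ τψ M x φ' ψ

end Law

/-! ### Regularity of functions of `(x, φ, ψ)` -/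

section Regularity

variable {d : ℕ} {S A B : Type*} [Fintype S] [Fintype A] [Fintype B]

/-- `F(x, φ, ψ)` as a function of one vector. -/
def joint (F : UpperVar d → Param S A → Param S B → ℝ) (z : FullVar d S A B) : ℝ :=
  F z.fst z.snd.fst z.snd.snd

/-- `F(x, φ, ψ)` as a function of `θ = (φ, ψ)` for fixed `x`. -/
def inTheta (F : UpperVar d → Param S A → Param S B → ℝ) (x : UpperVar d)
    (θ : JointParam S A B) : ℝ :=
  F x θ.fst θ.snd

/-- `‖x - x'‖ + ‖φ - φ'‖ + ‖ψ - ψ'‖`. -/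
def sumDist (z w : FullVar d S A B) : ℝ :=
  ‖z.fst - w.fst‖ + ‖z.snd.fst - w.snd.fst‖ + ‖z.snd.snd - w.snd.snd‖

/-- `F` is `C`-Lipschitz continuous in `(x, φ, ψ)`. -/
def LipschitzIn (C : ℝ) (F : UpperVar d → Param S A → Param S B → ℝ) : Prop :=
  ∀ z w, |joint F z - joint F w| ≤ C * sumDist z w

/-- `F` is `L`-smooth in `(x, φ, ψ)`: differentiable with an `L`-Lipschitz gradient. -/
def SmoothIn (L : ℝ) (F : UpperVar d → Param S A → Param S B → ℝ) : Prop :=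
  Differentiable ℝ (joint F) ∧
  ∀ z w, ‖gradient (joint F) z - gradient (joint F) w‖ ≤ L * sumDist z w

/-- `F` is twice differentiable in `(x, φ, ψ)` and its Hessian, the derivative of the gradient, is
`L`-Lipschitz. -/
def HessianLipschitzIn (L : ℝ) (F : UpperVar d → Param S A → Param S B → ℝ) : Prop :=
  Differentiable ℝ (joint F) ∧ Differentiable ℝ (gradient (joint F)) ∧
  ∀ z w, ‖fderiv ℝ (gradient (joint F)) z - fderiv ℝ (gradient (joint F)) w‖ ≤ L * sumDist z w

/-- The `μ`-Polyak–Łojasiewicz inequality of `F` in `(φ, ψ)`, for all `x` and all `φ ∈ Φ`, `ψ ∈ Ψ`.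
The infimum is over all parameters. -/
def PLIn (μ : ℝ) (Φ : Set (Param S A)) (Ψ : Set (Param S B))
    (F : UpperVar d → Param S A → Param S B → ℝ) : Prop :=
  ∀ x, Differentiable ℝ (inTheta F x) ∧ BddBelow (Set.range (inTheta F x)) ∧
    ∀ θ : JointParam S A B, θ.fst ∈ Φ → θ.snd ∈ Ψ →
      2 * μ * (inTheta F x θ - ⨅ θ', inTheta F x θ') ≤ ‖gradient (inTheta F x) θ‖ ^ 2

end Regularity

/-! ### Assumptions -/

section Assumptions

variable {d : ℕ} {S A B : Type*} [Fintype S] [Fintype A] [Fintype B]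

/-- The reward is bounded by `Br`, and `Cr`-Lipschitz and `Lr`-smooth in `x`; the policies with
parameters in `Φ` and `Ψ` are bounded below by `δπ`, the initial distribution by `δρ`. -/
structure GameAssumption [Nonempty A] [Nonempty B] (M : Game d S A B) (Br Cr Lr δπ δρ : ℝ)
    (Φ : Set (Param S A)) (Ψ : Set (Param S B)) : Prop where
  reward_bounded : ∀ x s a b, |M.reward x s a b| ≤ Br
  reward_lipschitz : ∀ s a b x x', |M.reward x s a b - M.reward x' s a b| ≤ Cr * ‖x - x'‖
  reward_differentiable : ∀ s a b, Differentiable ℝ fun x => M.reward x s a b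
  reward_smooth : ∀ s a b x x',
    ‖gradient (fun y => M.reward y s a b) x - gradient (fun y => M.reward y s a b) x'‖
      ≤ Lr * ‖x - x'‖
  policy_min : ∀ φ ∈ Φ, ∀ s a, δπ ≤ (policy φ s).1 a
  policy_max : ∀ ψ ∈ Ψ, ∀ s b, δπ ≤ (policy ψ s).1 b
  initial : ∀ s, δρ ≤ M.initial.1 s

/-- `F` is twice differentiable, `C`-Lipschitz, `L₁`-smooth and `L₂`-Hessian-Lipschitz. -/
structure FunctionAssumption (F : UpperVar d → Param S A → Param S B → ℝ) (C L₁ L₂ : ℝ) :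
    Prop where
  lipschitz : LipschitzIn C F
  smooth : SmoothIn L₁ F
  hessian : HessianLipschitzIn L₂ F

end Assumptions

end MarkovGame

end

/-!
The Nikaido–Isoda function splits as `g(x, φ, ψ) = h(x, φ) - h'(x, ψ)`, where `h = max_ψ J` and
`h' = min_φ J`; everything follows from a study of the two single-player problems.

*Single player.* With the opponent fixed, either player faces a finite entropy-regularised Markov
decision process with bounded rewards (`isSoftValue_max`, `isSoftValue_min`; the link with the
trajectory measure is the Bellman equation `value_bellman`). No visitation measure is needed: the
difference of two values solves a Poisson equation `U = c + γ P U` (`value_sub_eq`), and the maximum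
principle turns bounds for the one-step gain `c` into bounds for `U`. This gives

* optimal logits, from the fixed point of the soft Bellman operator. Normalised to have mean zero in
  each state, they lie in a ball which depends on the constants only; every other policy loses at
  least its relative entropy to the optimal one (`exists_optimal_logits`). Relative entropy is
  strongly convex in centred bounded logits, so `J` grows quadratically at the best response
  (`exists_bestResponse`);
* the Polyak–Łojasiewicz inequality of `J` in the parameter of one player (`discounted_reward_PL`):
  a partial derivative is at least `ρ(s) π(a | s)` times the advantage, and the squared advantages
  bound the suboptimality.

*Regularity of `g`.* Quadratic growth makes the Hessian of `J` in the maximised variable uniformly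
negative definite on centred logits. Hence the best response is Lipschitz and differentiable, with a
Lipschitz derivative, and by the envelope theorem `h` and `h'` inherit the regularity of `J`
(`IsQuadraticArgmax.lipschitzDerivs_max`).

*The inequality for `g`.* The gradient of `g` consists of the gradients of `J` in `φ` and in `ψ`,
each taken against the best response to the player concerned. Weak duality combines the two
single-player inequalities into the one for `g` (`BestResponses.PLIn_niFunction`); neither an
equilibrium nor the value of the infimum of `g` is needed.
-/

namespace MarkovGame

/-! ### The Bellman equation of the trajectory-defined value function -/

section Bellman

variable {d : ℕ} {S A B : Type*} [Fintype S] [Fintype A] [Fintype B]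

/-- A stage is a triple. -/
def stageEquiv (S A B : Type*) : Stage S A B ≃ S × A × B where
  toFun z := (z.state, z.actMin, z.actMax)
  invFun z := ⟨z.1, z.2.1, z.2.2⟩
  left_inv _ := rfl
  right_inv _ := rfl

noncomputable instance : Fintype (Stage S A B) := Fintype.ofEquiv _ (stageEquiv S A B).symm

lemma integral_toMeasure_bind {α β : Type*} [Fintype α] [Fintype β] [MeasurableSpace β]
    [MeasurableSingletonClass β] (p : PMF α) (κ : α → PMF β) (f : β → ℝ) :
    ∫ b, f b ∂(p.bind κ).toMeasure = ∑ a, (p a).toReal * ∫ b, f b ∂(κ a).toMeasure := by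
  simp only [PMF.integral_eq_sum, PMF.bind_apply, tsum_fintype, smul_eq_mul, Finset.mul_sum]
  rw [Finset.sum_comm]
  refine Finset.sum_congr rfl fun b _ => ?_
  rw [ENNReal.toReal_sum, Finset.sum_mul]
  · simp [mul_assoc]
  · intro a _
    exact ENNReal.mul_ne_top (PMF.apply_ne_top _ _) (PMF.apply_ne_top _ _)

lemma toReal_toPMF {ι : Type*} [Fintype ι] (p : stdSimplex ℝ ι) (i : ι) :
    (toPMF p i).toReal = p.1 i := by
  simp [toPMF, ENNReal.toReal_ofReal (p.2.1 i)]

lemma integral_stageLaw (p : S → stdSimplex ℝ A) (q : S → stdSimplex ℝ B) (s : S)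
    (f : Stage S A B → ℝ) :
    ∫ z, f z ∂(stageLaw p q s).toMeasure
      = ∑ a, (p s).1 a * ∑ b, (q s).1 b * f ⟨s, a, b⟩ := by
  simp only [stageLaw, integral_toMeasure_bind, toReal_toPMF, PMF.toMeasure_pure, integral_dirac]

lemma integral_stepKernel (M : Game d S A B) (p : S → stdSimplex ℝ A) (q : S → stdSimplex ℝ B)
    (z : Stage S A B) (f : Stage S A B → ℝ) :
    ∫ z', f z' ∂(stepKernel M p q z)
      = ∑ s, (M.transition z.state z.actMin z.actMax).1 s *
          ∫ z', f z' ∂(stageLaw p q s).toMeasure := by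
  change ∫ z', f z' ∂((toPMF (M.transition z.state z.actMin z.actMax)).bind
    (stageLaw p q)).toMeasure = _
  simp only [integral_toMeasure_bind, toReal_toPMF]

instance (M : Game d S A B) (p : S → stdSimplex ℝ A) (q : S → stdSimplex ℝ B) (s : S) :
    IsProbabilityMeasure (trajectoryLaw M p q s) := by
  have : IsProbabilityMeasure (stageLaw p q s).toMeasure :=
    PMF.toMeasure.isProbabilityMeasure _
  unfold trajectoryLaw
  exact inferInstanceAs (IsProbabilityMeasure
    (Kernel.trajMeasure (X := fun _ => Stage S A B) (stageLaw p q s).toMeasure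
      (historyKernel M p q)))

lemma integrable_eval (M : Game d S A B) (p : S → stdSimplex ℝ A)
    (q : S → stdSimplex ℝ B) (s : S) (t : ℕ) (f : Stage S A B → ℝ) :
    Integrable (fun ω : ℕ → Stage S A B => f (ω t)) (trajectoryLaw M p q s) := by
  have hm : Measurable (fun ω : ℕ → Stage S A B => f (ω t)) :=
    (Measurable.of_discrete (f := f)).comp (measurable_pi_apply t)
  refine Integrable.of_bound hm.aestronglyMeasurable (∑ z, |f z|) (Filter.Eventually.of_forall ?_)
  intro ω
  rw [Real.norm_eq_abs]
  exact Finset.single_le_sum (f := fun z => |f z|) (fun z _ => abs_nonneg _) (Finset.mem_univ _)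

lemma integral_eval_zero (M : Game d S A B) (p : S → stdSimplex ℝ A)
    (q : S → stdSimplex ℝ B) (s : S) (f : Stage S A B → ℝ) :
    ∫ ω, f (ω 0) ∂(trajectoryLaw M p q s) = ∫ z, f z ∂(stageLaw p q s).toMeasure := by
  have : IsProbabilityMeasure (stageLaw p q s).toMeasure :=
    PMF.toMeasure.isProbabilityMeasure _
  have hmap : (trajectoryLaw M p q s).map (fun ω => ω 0) = (stageLaw p q s).toMeasure := by
    have h1 : (trajectoryLaw M p q s).map (Preorder.frestrictLe 0)
        = (stageLaw p q s).toMeasure.map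
          (MeasurableEquiv.piUnique (fun _ : Finset.Iic 0 => Stage S A B)).symm := by
      unfold trajectoryLaw Kernel.trajMeasure
      rw [Measure.map_comp _ _ (by fun_prop), Kernel.traj_map_frestrictLe,
        Kernel.partialTraj_self, Measure.id_comp]
    have h2 : (fun ω : ℕ → Stage S A B => ω 0)
        = (fun x : (Π _ : Finset.Iic 0, Stage S A B) => x ⟨0, by simp⟩) ∘
          (Preorder.frestrictLe (π := fun _ => Stage S A B) 0) := rfl
    rw [h2, ← Measure.map_map (by fun_prop) (by fun_prop), h1,
      Measure.map_map (by fun_prop) (by fun_prop)]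
    exact Measure.map_id
  rw [← hmap, integral_map (measurable_pi_apply 0).aemeasurable
    (Measurable.of_discrete).aestronglyMeasurable]

lemma integral_eval_succ (M : Game d S A B) (p : S → stdSimplex ℝ A)
    (q : S → stdSimplex ℝ B) (s : S) (t : ℕ) (f : Stage S A B → ℝ) :
    ∫ ω, f (ω (t + 1)) ∂(trajectoryLaw M p q s)
      = ∫ ω, (∫ z', f z' ∂(stepKernel M p q (ω t))) ∂(trajectoryLaw M p q s) := by
  have : IsProbabilityMeasure (stageLaw p q s).toMeasure :=
    PMF.toMeasure.isProbabilityMeasure _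
  have key := Kernel.map_frestrictLe_trajMeasure_compProd_eq_map_trajMeasure
    (X := fun _ => Stage S A B) (κ := historyKernel M p q)
    (μ₀ := (stageLaw p q s).toMeasure) (a := t)
  change (trajectoryLaw M p q s).map _ ⊗ₘ _ = (trajectoryLaw M p q s).map _ at key
  have hf : Measurable f := Measurable.of_discrete
  have hI : Integrable (fun x : (Π _ : Finset.Iic t, Stage S A B) × Stage S A B => f x.2)
      ((trajectoryLaw M p q s).map
        (fun x => (Preorder.frestrictLe (π := fun _ => Stage S A B) t x, x (t + 1)))) := by
    have hs : Measurable fun x : (Π _ : Finset.Iic t, Stage S A B) × Stage S A B => f x.2 :=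
      hf.comp measurable_snd
    rw [integrable_map_measure hs.aestronglyMeasurable (by fun_prop)]
    exact integrable_eval M p q s (t + 1) f
  have h1 := integral_map (μ := trajectoryLaw M p q s)
    (φ := fun x => (Preorder.frestrictLe (π := fun _ => Stage S A B) t x, x (t + 1)))
    (f := fun x => f x.2) (by fun_prop) (hf.comp measurable_snd).aestronglyMeasurable
  rw [← h1, ← key]
  rw [← key] at hI
  rw [Measure.integral_compProd hI, integral_map (by fun_prop)]
  · rfl
  · refine Measurable.aestronglyMeasurable ?_
    change Measurable (fun x : (Π _ : Finset.Iic t, Stage S A B) =>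
      ∫ y, f y ∂(stepKernel M p q (x ⟨t, Finset.mem_Iic.2 le_rfl⟩)))
    exact (Measurable.of_discrete (f := fun z => ∫ y, f y ∂(stepKernel M p q z))).comp
      (measurable_pi_apply _)

lemma integral_eval_eq_iterate (M : Game d S A B) (p : S → stdSimplex ℝ A)
    (q : S → stdSimplex ℝ B) (s : S) (t : ℕ) (f : Stage S A B → ℝ) :
    ∫ ω, f (ω t) ∂(trajectoryLaw M p q s)
      = ∫ z, ((fun (g : Stage S A B → ℝ) z => ∫ z', g z' ∂(stepKernel M p q z))^[t] f) z
          ∂(stageLaw p q s).toMeasure := by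
  induction t generalizing f with
  | zero => exact integral_eval_zero M p q s f
  | succ t ih => rw [integral_eval_succ, ih (fun z => ∫ z', f z' ∂(stepKernel M p q z)),
      Function.iterate_succ_apply]

/-- The value function satisfies the Bellman equation. -/
theorem value_bellman {γ : ℝ} (hγ0 : 0 < γ) (hγ1 : γ < 1) (τφ τψ : ℝ) (M : Game d S A B)
    (x : UpperVar d) (p : S → stdSimplex ℝ A) (q : S → stdSimplex ℝ B) (s : S) :
    value γ τφ τψ M x p q s
      = ∑ a, (p s).1 a * ∑ b, (q s).1 b *
          (M.reward x s a b + regularizer τφ τψ (p s) (q s)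
            + γ * ∑ s', (M.transition s a b).1 s' * value γ τφ τψ M x p q s') := by
  set f : Stage S A B → ℝ := fun z => M.reward x z.state z.actMin z.actMax
    + regularizer τφ τψ (p z.state) (q z.state) with hf
  set K : (Stage S A B → ℝ) → (Stage S A B → ℝ) :=
    fun g z => ∫ z', g z' ∂(stepKernel M p q z) with hK
  have hsum : ∀ s, HasSum (fun t => γ ^ t * ∫ z, (K^[t] f) z ∂(stageLaw p q s).toMeasure)
      (value γ τφ τψ M x p q s) := by
    intro s
    have h := hasSum_integral_of_summable_integral_norm (μ := trajectoryLaw M p q s)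
      (F := fun t ω => γ ^ t * f (ω t))
      (fun t => (integrable_eval M p q s t f).const_mul _) ?_
    · have e : ∀ t, ∫ ω, γ ^ t * f (ω t) ∂(trajectoryLaw M p q s)
          = γ ^ t * ∫ z, (K^[t] f) z ∂(stageLaw p q s).toMeasure := by
        intro t
        rw [integral_const_mul, integral_eval_eq_iterate]
      simp only [e] at h
      exact h
    · refine Summable.of_nonneg_of_le (fun t => integral_nonneg fun _ => norm_nonneg _) ?_
        ((summable_geometric_of_lt_one hγ0.le hγ1).mul_right (∑ z, |f z|))
      intro t
      have hb : ∀ ω : ℕ → Stage S A B, ‖γ ^ t * f (ω t)‖ ≤ γ ^ t * ∑ z, |f z| := by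
        intro ω
        rw [norm_mul, Real.norm_eq_abs, Real.norm_eq_abs, abs_of_pos (pow_pos hγ0 t)]
        exact mul_le_mul_of_nonneg_left (Finset.single_le_sum (f := fun z => |f z|)
          (fun z _ => abs_nonneg _) (Finset.mem_univ _)) (pow_pos hγ0 t).le
      calc ∫ ω, ‖γ ^ t * f (ω t)‖ ∂(trajectoryLaw M p q s)
          ≤ ∫ _ω, γ ^ t * ∑ z, |f z| ∂(trajectoryLaw M p q s) :=
            integral_mono ((integrable_eval M p q s t f).const_mul _).norm
              (integrable_const _) hb
        _ = γ ^ t * ∑ z, |f z| := by simp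
  have hsucc : ∀ t, γ ^ (t + 1) * ∫ z, (K^[t + 1] f) z ∂(stageLaw p q s).toMeasure
      = ∑ a, (p s).1 a * ∑ b, (q s).1 b * (γ * ∑ s', (M.transition s a b).1 s' *
          (γ ^ t * ∫ z, (K^[t] f) z ∂(stageLaw p q s').toMeasure)) := by
    intro t
    rw [Function.iterate_succ_apply', integral_stageLaw, Finset.mul_sum]
    refine Finset.sum_congr rfl fun a _ => ?_
    rw [mul_left_comm, Finset.mul_sum]
    congr 1
    refine Finset.sum_congr rfl fun b _ => ?_
    rw [mul_left_comm]
    congr 1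
    rw [hK]
    simp only [integral_stepKernel]
    rw [Finset.mul_sum, Finset.mul_sum]
    refine Finset.sum_congr rfl fun s' _ => ?_
    ring
  have h0 := hsum s
  rw [← hasSum_nat_add_iff' 1] at h0
  simp only [hsucc] at h0
  have h1 : HasSum (fun t : ℕ => ∑ a, (p s).1 a * ∑ b, (q s).1 b * (γ *
      ∑ s', (M.transition s a b).1 s' *
        (γ ^ t * ∫ z, (K^[t] f) z ∂(stageLaw p q s').toMeasure)))
      (∑ a, (p s).1 a * ∑ b, (q s).1 b * (γ * ∑ s', (M.transition s a b).1 s' *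
        value γ τφ τψ M x p q s')) :=
    hasSum_sum fun a _ => HasSum.mul_left _ <| hasSum_sum fun b _ => HasSum.mul_left _ <|
      HasSum.mul_left _ <| hasSum_sum fun s' _ => HasSum.mul_left _ (hsum s')
  have h2 := h0.unique h1
  simp only [Finset.range_one, Finset.sum_singleton, pow_zero, one_mul,
    Function.iterate_zero, id_eq] at h2
  rw [integral_stageLaw] at h2
  rw [sub_eq_iff_eq_add'.1 h2]
  simp only [mul_add, Finset.sum_add_distrib, hf]

end Bellman

/-! ### Softmax distributions and relative entropy -/

section Softmax

variable {A : Type*} [Fintype A]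

/-- The relative entropy `∑ p(a) log (p(a) / q(a))`; it is only used for `q > 0`. -/
noncomputable def relEntropy (p q : stdSimplex ℝ A) : ℝ :=
  ∑ a, p.1 a * (Real.log (p.1 a) - Real.log (q.1 a))

lemma relEntropy_self (p : stdSimplex ℝ A) : relEntropy p p = 0 := by
  simp [relEntropy]

lemma simplex_le_one (p : stdSimplex ℝ A) (a : A) : p.1 a ≤ 1 := by
  rw [← p.2.2]
  exact Finset.single_le_sum (f := p.1) (fun i _ => p.2.1 i) (Finset.mem_univ a)

lemma entropy_nonneg (p : stdSimplex ℝ A) : 0 ≤ entropy p :=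
  Finset.sum_nonneg fun a _ => Real.negMulLog_nonneg (p.2.1 a) (simplex_le_one p a)

lemma entropy_le_card (p : stdSimplex ℝ A) : entropy p ≤ Fintype.card A := by
  have h : ∀ a, Real.negMulLog (p.1 a) ≤ 1 := by
    intro a
    rcases (p.2.1 a).eq_or_lt with h | h
    · rw [← h]; simp
    · have h1 := Real.one_sub_inv_le_log_of_pos h
      have h2 : p.1 a * (1 - (p.1 a)⁻¹) ≤ p.1 a * Real.log (p.1 a) :=
        mul_le_mul_of_nonneg_left h1 h.le
      rw [mul_sub, mul_inv_cancel₀ h.ne'] at h2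
      rw [Real.negMulLog]
      linarith
  calc entropy p ≤ ∑ _a : A, (1 : ℝ) := Finset.sum_le_sum fun a _ => h a
    _ = Fintype.card A := by simp

/-- The integrand of the relative entropy, made non-negative by adding `q - p`, dominates
`(√p - √q) ^ 2`. -/
lemma sq_sub_le_relEntropy_term {p q : ℝ} (hp : 0 ≤ p) (hp1 : p ≤ 1) (hq : 0 < q) (hq1 : q ≤ 1) :
    (p - q) ^ 2 / 4 ≤ p * (Real.log p - Real.log q) - p + q := by
  obtain ⟨x, hx, rfl⟩ : ∃ x : ℝ, 0 ≤ x ∧ p = x ^ 2 :=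
    ⟨√p, Real.sqrt_nonneg _, (Real.sq_sqrt hp).symm⟩
  obtain ⟨y, hy, rfl⟩ : ∃ y : ℝ, 0 < y ∧ q = y ^ 2 :=
    ⟨√q, Real.sqrt_pos.2 hq, (Real.sq_sqrt hq.le).symm⟩
  have hx1 : x ≤ 1 := by nlinarith
  have hy1 : y ≤ 1 := by nlinarith
  have hlog : 2 * x ^ 2 - 2 * (x * y) ≤ x ^ 2 * (Real.log (x ^ 2) - Real.log (y ^ 2)) := by
    rcases hx.eq_or_lt with h | h
    · rw [← h]; simp
    · have h1 : Real.log (y / x) ≤ y / x - 1 := Real.log_le_sub_one_of_pos (div_pos hy h)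
      rw [Real.log_div hy.ne' h.ne'] at h1
      rw [Real.log_pow, Real.log_pow]
      have h2 : x ^ 2 * (y / x - 1) = x * y - x ^ 2 := by field_simp
      have h3 := mul_le_mul_of_nonneg_left h1 (sq_nonneg x)
      push_cast
      linarith
  have hs : (x + y) ^ 2 ≤ 4 := by nlinarith
  have : (x ^ 2 - y ^ 2) ^ 2 / 4 ≤ (x - y) ^ 2 := by
    have := mul_le_mul_of_nonneg_left hs (sq_nonneg (x - y))
    nlinarith
  nlinarith

/-- A Pinsker-type inequality in the Euclidean norm. -/
lemma sum_sq_sub_le_relEntropy (p q : stdSimplex ℝ A) (hq : ∀ a, 0 < q.1 a) :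
    (∑ a, (p.1 a - q.1 a) ^ 2) / 4 ≤ relEntropy p q := by
  have h : ∑ a, (p.1 a - q.1 a) ^ 2 / 4
      ≤ ∑ a, (p.1 a * (Real.log (p.1 a) - Real.log (q.1 a)) - p.1 a + q.1 a) :=
    Finset.sum_le_sum fun a _ => sq_sub_le_relEntropy_term (p.2.1 a) (simplex_le_one p a) (hq a)
      (simplex_le_one q a)
  rw [Finset.sum_add_distrib, Finset.sum_sub_distrib, p.2.2, q.2.2] at h
  rw [Finset.sum_div, relEntropy]
  linarith

lemma relEntropy_nonneg (p q : stdSimplex ℝ A) (hq : ∀ a, 0 < q.1 a) : 0 ≤ relEntropy p q :=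
  le_trans (by positivity) (sum_sq_sub_le_relEntropy p q hq)

variable [Nonempty A]

lemma sum_exp_pos (v : A → ℝ) : 0 < ∑ a, Real.exp (v a) :=
  Finset.sum_pos (fun _ _ => Real.exp_pos _) Finset.univ_nonempty

lemma softmax_apply (v : A → ℝ) (a : A) :
    (softmax v).1 a = Real.exp (v a) / ∑ a', Real.exp (v a') := rfl

lemma softmax_pos (v : A → ℝ) (a : A) : 0 < (softmax v).1 a :=
  div_pos (Real.exp_pos _) (sum_exp_pos v)

lemma log_softmax (v : A → ℝ) (a : A) :
    Real.log ((softmax v).1 a) = v a - Real.log (∑ a', Real.exp (v a')) := by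
  rw [softmax_apply, Real.log_div (Real.exp_pos _).ne' (sum_exp_pos v).ne', Real.log_exp]

lemma softmax_sub_const (v : A → ℝ) (c : ℝ) : softmax (fun a => v a - c) = softmax v := by
  apply Subtype.ext
  funext a
  simp only [softmax_apply, Real.exp_sub, ← Finset.sum_div]
  rw [div_div_div_cancel_right₀ (Real.exp_pos c).ne']

lemma softmax_lower_bound {v : A → ℝ} {r : ℝ} (hv : ∀ a, |v a| ≤ r) (a : A) :
    Real.exp (-(2 * r)) / Fintype.card A ≤ (softmax v).1 a := by
  have hn : (0 : ℝ) < Fintype.card A := by exact_mod_cast Fintype.card_pos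
  have hs : ∑ a', Real.exp (v a') ≤ Fintype.card A * Real.exp r := by
    calc ∑ a', Real.exp (v a') ≤ ∑ _a' : A, Real.exp r :=
          Finset.sum_le_sum fun a' _ => Real.exp_le_exp.2 (le_of_abs_le (hv a'))
      _ = _ := by simp
  rw [softmax_apply, div_le_div_iff₀ hn (sum_exp_pos v)]
  calc Real.exp (-(2 * r)) * ∑ a', Real.exp (v a')
      ≤ Real.exp (-(2 * r)) * (Fintype.card A * Real.exp r) :=
        mul_le_mul_of_nonneg_left hs (Real.exp_pos _).le
    _ = Real.exp (-r) * Fintype.card A := by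
        rw [mul_left_comm, ← Real.exp_add, mul_comm]; ring_nf
    _ ≤ Real.exp (v a) * Fintype.card A :=
        mul_le_mul_of_nonneg_right (Real.exp_le_exp.2 (neg_le_of_abs_le (hv a))) hn.le

lemma abs_log_sub_log_le {p q δ : ℝ} (hδ : 0 < δ) (hp : δ ≤ p) (hq : δ ≤ q) :
    |Real.log p - Real.log q| ≤ |p - q| / δ := by
  have key : ∀ {p q : ℝ}, δ ≤ p → δ ≤ q → Real.log p - Real.log q ≤ |p - q| / δ := by
    intro p q hp hq
    have hp0 := hδ.trans_le hp
    have hq0 := hδ.trans_le hq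
    rw [← Real.log_div hp0.ne' hq0.ne']
    calc Real.log (p / q) ≤ p / q - 1 := Real.log_le_sub_one_of_pos (div_pos hp0 hq0)
      _ = (p - q) / q := by field_simp
      _ ≤ |p - q| / q := by gcongr; exact le_abs_self _
      _ ≤ |p - q| / δ := by gcongr
  rw [abs_le]
  refine ⟨?_, key hp hq⟩
  have := key hq hp
  rw [abs_sub_comm] at this
  linarith

/-- Relative entropy is strongly convex in the logits, as long as these are normalised to have mean
zero and the policies stay away from the boundary of the simplex. -/
lemma sum_sq_logits_le_relEntropy {u v : A → ℝ} {δ : ℝ} (hδ : 0 < δ)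
    (hu : ∀ a, δ ≤ (softmax u).1 a) (hv : ∀ a, δ ≤ (softmax v).1 a)
    (hu0 : ∑ a, u a = 0) (hv0 : ∑ a, v a = 0) :
    δ ^ 2 / 4 * ∑ a, (u a - v a) ^ 2 ≤ relEntropy (softmax u) (softmax v) := by
  refine le_trans ?_ (sum_sq_sub_le_relEntropy _ _ (softmax_pos v))
  -- Logarithms of softmax probabilities are the logits up to the constants in `k`.
  set k := Real.log (∑ a', Real.exp (u a')) - Real.log (∑ a', Real.exp (v a')) with hk
  have h1 : ∀ a, δ ^ 2 * (u a - v a - k) ^ 2 ≤ ((softmax u).1 a - (softmax v).1 a) ^ 2 := by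
    intro a
    have h := abs_log_sub_log_le hδ (hu a) (hv a)
    rw [le_div_iff₀ hδ, log_softmax, log_softmax] at h
    have e : u a - Real.log (∑ a', Real.exp (u a')) - (v a - Real.log (∑ a', Real.exp (v a')))
        = u a - v a - k := by rw [hk]; ring
    rw [e] at h
    rw [← sq_abs ((softmax u).1 a - _), ← mul_pow, ← sq_abs (δ * _), abs_mul, abs_of_pos hδ]
    gcongr
    linarith
  -- Since `u - v` has mean zero, subtracting a constant only increases the sum of squares.
  have h2 : ∑ a, (u a - v a) ^ 2 ≤ ∑ a, (u a - v a - k) ^ 2 := by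
    have e : ∀ a, (u a - v a - k) ^ 2 = (u a - v a) ^ 2 - 2 * k * (u a - v a) + k ^ 2 :=
      fun a => by ring
    simp only [e]
    rw [Finset.sum_add_distrib, Finset.sum_sub_distrib, ← Finset.mul_sum,
      Finset.sum_sub_distrib, hu0, hv0]
    have : 0 ≤ ∑ _a : A, k ^ 2 := by positivity
    linarith
  calc δ ^ 2 / 4 * ∑ a, (u a - v a) ^ 2 ≤ δ ^ 2 / 4 * ∑ a, (u a - v a - k) ^ 2 := by gcongr
    _ = (∑ a, δ ^ 2 * (u a - v a - k) ^ 2) / 4 := by rw [← Finset.mul_sum]; ring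
    _ ≤ _ := by gcongr with a; exact h1 a

/-! ### The effect of moving one logit -/

section Perturb

variable (v : A → ℝ) (a : A) (t : ℝ)

/-- The factor by which the partition function grows when the logit of `a` increases by `t`. -/
noncomputable def partitionRatio : ℝ := 1 + (softmax v).1 a * (Real.exp t - 1)

/-- The function differentiated here is the one-step gain of moving the logit of `a` by `t`, for an
advantage `c` of `a`: compare `sum_softmax_perturb_mul` and `relEntropy_perturb`. The relative
entropy is of second order. -/
lemma hasDerivAt_perturb_gain (τ c : ℝ) :
    HasDerivAt (fun t => (softmax v).1 a * (Real.exp t - 1) * c / partitionRatio v a t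
      - τ * (t * ((softmax v).1 a * Real.exp t / partitionRatio v a t)
        - Real.log (partitionRatio v a t))) ((softmax v).1 a * c) 0 := by
  have hN : HasDerivAt (fun t => partitionRatio v a t) ((softmax v).1 a) 0 := by
    have := (((Real.hasDerivAt_exp 0).sub_const 1).const_mul ((softmax v).1 a)).const_add 1
    simpa [partitionRatio] using this
  have hN0 : partitionRatio v a 0 = 1 := by simp [partitionRatio]
  have hne : partitionRatio v a 0 ≠ 0 := by rw [hN0]; exact one_ne_zero
  have h1 := ((((Real.hasDerivAt_exp 0).sub_const 1).const_mul ((softmax v).1 a)).mul_const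
    c).div hN hne
  have h2 := (hasDerivAt_id (0 : ℝ)).mul
    (((Real.hasDerivAt_exp 0).const_mul ((softmax v).1 a)).div hN hne)
  have h3 := h1.sub ((h2.sub (hN.log hne)).const_mul τ)
  refine h3.congr_deriv ?_
  simp [hN0]

variable [DecidableEq A]

lemma sum_exp_perturb :
    ∑ a', Real.exp (v a' + if a' = a then t else 0)
      = (∑ a', Real.exp (v a')) * partitionRatio v a t := by
  have h : ∀ a', Real.exp (v a' + if a' = a then t else 0)
      = Real.exp (v a') + if a' = a then Real.exp (v a) * (Real.exp t - 1) else 0 := by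
    intro a'
    split_ifs with h
    · rw [h, Real.exp_add]; ring
    · simp
  simp only [h, Finset.sum_add_distrib, Finset.sum_ite_eq', Finset.mem_univ, if_true]
  have := (sum_exp_pos v).ne'
  rw [partitionRatio, softmax_apply]
  field_simp

lemma partitionRatio_pos : 0 < partitionRatio v a t := by
  have h := sum_exp_pos (fun a' => v a' + if a' = a then t else 0)
  rw [sum_exp_perturb] at h
  exact pos_of_mul_pos_right h (sum_exp_pos v).le

lemma softmax_perturb (a' : A) :
    (softmax fun a' => v a' + if a' = a then t else 0).1 a'
      = ((softmax v).1 a' + if a' = a then (softmax v).1 a * (Real.exp t - 1) else 0)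
          / partitionRatio v a t := by
  have h0 := (sum_exp_pos v).ne'
  have h1 := (partitionRatio_pos v a t).ne'
  rw [softmax_apply, sum_exp_perturb]
  simp only [softmax_apply]
  split_ifs with h
  · rw [h, Real.exp_add]; field_simp; ring
  · simp; field_simp

lemma relEntropy_perturb :
    relEntropy (softmax fun a' => v a' + if a' = a then t else 0) (softmax v)
      = t * ((softmax v).1 a * Real.exp t / partitionRatio v a t)
        - Real.log (partitionRatio v a t) := by
  set v' : A → ℝ := fun a' => v a' + if a' = a then t else 0 with hv'
  have hlog : ∀ a', Real.log ((softmax v').1 a') - Real.log ((softmax v).1 a')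
      = (if a' = a then t else 0) - Real.log (partitionRatio v a t) := by
    intro a'
    rw [log_softmax, log_softmax, hv', sum_exp_perturb,
      Real.log_mul (sum_exp_pos v).ne' (partitionRatio_pos v a t).ne']
    ring
  simp only [relEntropy, hlog, mul_sub, Finset.sum_sub_distrib, ← Finset.sum_mul,
    (softmax v').2.2, one_mul, mul_ite, mul_zero, Finset.sum_ite_eq', Finset.mem_univ, if_true]
  rw [hv', softmax_perturb]
  simp only [if_true]
  ring

lemma sum_softmax_perturb_mul (f : A → ℝ) (hf : ∑ a', (softmax v).1 a' * f a' = 0) :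
    ∑ a', (softmax fun a' => v a' + if a' = a then t else 0).1 a' * f a'
      = (softmax v).1 a * (Real.exp t - 1) * f a / partitionRatio v a t := by
  simp only [softmax_perturb, div_mul_eq_mul_div, ← Finset.sum_div, add_mul,
    Finset.sum_add_distrib, hf, zero_add, ite_mul, zero_mul, Finset.sum_ite_eq', Finset.mem_univ,
    if_true]

end Perturb

end Softmax

/-! ### Entropy-regularised Markov decision processes -/

section MDP

variable {S A : Type*} [Fintype S] [Fintype A]

/-- The state-action value `Q(s,a) = R(s,a) + γ ∑ P(s' | s,a) V(s')` belonging to a state value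
`V`. -/
def qValue (γ : ℝ) (R : S → A → ℝ) (P : S → A → stdSimplex ℝ S) (V : S → ℝ) (s : S) (a : A) : ℝ :=
  R s a + γ * ∑ s', (P s a).1 s' * V s'

/-- `V` is the value of the policy `π` in the Markov decision process with reward `R`, transition
kernel `P` and entropy bonus `τ`: it solves the Bellman equation. -/
def IsSoftValue (γ τ : ℝ) (R : S → A → ℝ) (P : S → A → stdSimplex ℝ S)
    (π : S → stdSimplex ℝ A) (V : S → ℝ) : Prop :=
  ∀ s, V s = ∑ a, (π s).1 a * qValue γ R P V s a + τ * entropy (π s)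

/-- The expectation of `U` after one step under the policy `π`. -/
def stepMean (P : S → A → stdSimplex ℝ S) (π : S → stdSimplex ℝ A) (U : S → ℝ) (s : S) : ℝ :=
  ∑ a, (π s).1 a * ∑ s', (P s a).1 s' * U s'

/-- How much using `π` for one step improves on the state value `V`. -/
noncomputable def gain (γ τ : ℝ) (R : S → A → ℝ) (P : S → A → stdSimplex ℝ S) (V : S → ℝ)
    (π : S → stdSimplex ℝ A) (s : S) : ℝ :=
  ∑ a, (π s).1 a * qValue γ R P V s a + τ * entropy (π s) - V s

/-- The advantage function of a policy `π`, relative to a state value `V`. -/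
noncomputable def advantage (γ τ : ℝ) (R : S → A → ℝ) (P : S → A → stdSimplex ℝ S) (V : S → ℝ)
    (π : S → stdSimplex ℝ A) (s : S) (a : A) : ℝ :=
  qValue γ R P V s a - τ * Real.log ((π s).1 a) - V s

variable {γ τ : ℝ} {R : S → A → ℝ} {P : S → A → stdSimplex ℝ S} {π π' : S → stdSimplex ℝ A}
  {V V' : S → ℝ}

lemma stepMean_neg (U : S → ℝ) (s : S) : stepMean P π (fun s => - U s) s = - stepMean P π U s := by
  simp [stepMean]

lemma simplex_sum_le {ι : Type*} [Fintype ι] (p : stdSimplex ℝ ι) {f : ι → ℝ} {c : ℝ}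
    (h : ∀ i, f i ≤ c) : ∑ i, p.1 i * f i ≤ c := by
  calc ∑ i, p.1 i * f i ≤ ∑ i, p.1 i * c :=
        Finset.sum_le_sum fun i _ => mul_le_mul_of_nonneg_left (h i) (p.2.1 i)
    _ = c := by rw [← Finset.sum_mul, p.2.2, one_mul]

lemma simplex_abs_sum_le {ι : Type*} [Fintype ι] (p : stdSimplex ℝ ι) {f : ι → ℝ} {c : ℝ}
    (h : ∀ i, |f i| ≤ c) : |∑ i, p.1 i * f i| ≤ c := by
  rw [abs_le]
  constructor
  · have := simplex_sum_le p (f := fun i => - f i) (c := c) fun i => by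
      have := neg_le_of_abs_le (h i); linarith
    simp only [mul_neg, Finset.sum_neg_distrib] at this
    linarith
  · exact simplex_sum_le p fun i => le_of_abs_le (h i)

/-- The maximum principle for the discounted Poisson equation `U = c + γ P U`. -/
lemma le_div_of_poisson (hγ0 : 0 < γ) (hγ1 : γ < 1) {U c : S → ℝ} {C : ℝ}
    (hU : ∀ s, U s = c s + γ * stepMean P π U s) (hc : ∀ s, c s ≤ C) (s : S) :
    U s ≤ C / (1 - γ) := by
  have : Nonempty S := ⟨s⟩
  obtain ⟨s₀, hs₀⟩ := Finite.exists_max U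
  have h1 : stepMean P π U s₀ ≤ U s₀ :=
    simplex_sum_le _ fun a => simplex_sum_le _ fun s' => hs₀ s'
  have h2 := hU s₀
  have h3 := mul_le_mul_of_nonneg_left h1 hγ0.le
  rw [le_div_iff₀ (by linarith)]
  have h4 := mul_le_mul_of_nonneg_right (hs₀ s) (sub_nonneg.2 hγ1.le)
  have h5 := hc s₀
  linarith

lemma le_of_poisson (hγ0 : 0 < γ) (hγ1 : γ < 1) {U c : S → ℝ}
    (hU : ∀ s, U s = c s + γ * stepMean P π U s) (hc : ∀ s, c s ≤ 0) (s : S) : U s ≤ c s := by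
  have h := le_div_of_poisson hγ0 hγ1 hU hc
  have h1 : stepMean P π U s ≤ 0 :=
    simplex_sum_le _ fun a => simplex_sum_le _ fun s' => by simpa using h s'
  rw [hU s]
  nlinarith

lemma ge_of_poisson (hγ0 : 0 < γ) (hγ1 : γ < 1) {U c : S → ℝ}
    (hU : ∀ s, U s = c s + γ * stepMean P π U s) (hc : ∀ s, 0 ≤ c s) (s : S) : c s ≤ U s := by
  have h := le_of_poisson (P := P) (π := π) hγ0 hγ1 (U := fun s => - U s) (c := fun s => - c s)
    (fun s => by rw [stepMean_neg, hU s]; ring) (fun s => by simpa using hc s) s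
  simpa using h

/-- The performance difference identity: the difference to the value of `π'` solves a Poisson
equation whose right-hand side is the one-step gain of `π'`. -/
lemma value_sub_eq (h' : IsSoftValue γ τ R P π' V') (V : S → ℝ) (s : S) :
    V' s - V s = gain γ τ R P V π' s + γ * stepMean P π' (fun s => V' s - V s) s := by
  rw [h' s, gain, stepMean]
  simp only [qValue, mul_sub, mul_add, Finset.sum_sub_distrib, Finset.sum_add_distrib,
    Finset.mul_sum]
  simp only [mul_left_comm γ]
  ring

/-- The gain of `π'` in terms of the advantages of any reference policy `π`. -/
lemma gain_eq (V : S → ℝ) (π π' : S → stdSimplex ℝ A) (s : S) :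
    gain γ τ R P V π' s
      = ∑ a, (π' s).1 a * advantage γ τ R P V π s a - τ * relEntropy (π' s) (π s) := by
  simp only [gain, advantage, relEntropy, entropy, Real.negMulLog, mul_sub,
    Finset.sum_sub_distrib, ← Finset.sum_mul, (π' s).2.2, Finset.mul_sum, one_mul]
  rw [← Finset.sum_sub_distrib, ← sub_eq_zero]
  simp only [neg_mul, mul_neg, Finset.sum_neg_distrib, mul_left_comm τ, Finset.sum_sub_distrib]
  ring

lemma gain_self (h : IsSoftValue γ τ R P π V) (s : S) : gain γ τ R P V π s = 0 := by
  rw [gain, ← h s, sub_self]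

lemma sum_mul_advantage_self (h : IsSoftValue γ τ R P π V) (s : S) :
    ∑ a, (π s).1 a * advantage γ τ R P V π s a = 0 := by
  have := gain_eq (γ := γ) (τ := τ) (R := R) (P := P) V π π s
  rw [gain_self h, relEntropy_self] at this
  linarith

/-- No policy improves on `π` by more than its squared advantages. -/
lemma value_sub_le (hγ0 : 0 < γ) (hγ1 : γ < 1) (hτ : 0 < τ) (hπ : ∀ s a, 0 < (π s).1 a)
    (h : IsSoftValue γ τ R P π V) (h' : IsSoftValue γ τ R P π' V') (s : S) :
    V' s - V s ≤ (∑ s, ∑ a, advantage γ τ R P V π s a ^ 2) / τ / (1 - γ) := by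
  refine le_div_of_poisson (P := P) (π := π') hγ0 hγ1 (U := fun s => V' s - V s)
    (value_sub_eq h' V) (fun s => ?_) s
  rw [gain_eq V π π']
  have h1 := sum_sq_sub_le_relEntropy (π' s) (π s) (hπ s)
  have h2 := mul_le_mul_of_nonneg_left h1 hτ.le
  have h3 : ∑ a, (π' s).1 a * advantage γ τ R P V π s a
      = ∑ a, ((π' s).1 a - (π s).1 a) * advantage γ τ R P V π s a := by
    simp only [sub_mul, Finset.sum_sub_distrib, sum_mul_advantage_self h, sub_zero]
  have h4 : ∑ a, ((π' s).1 a - (π s).1 a) * advantage γ τ R P V π s a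
      ≤ ∑ a, (τ * (((π' s).1 a - (π s).1 a) ^ 2 / 4) + advantage γ τ R P V π s a ^ 2 / τ) := by
    refine Finset.sum_le_sum fun a _ => ?_
    -- Young's inequality, with the square in the policies absorbed by the relative entropy.
    set X := (π' s).1 a - (π s).1 a
    set Y := advantage γ τ R P V π s a
    have e : τ * (X ^ 2 / 4) + Y ^ 2 / τ - X * Y = (τ * X / 2 - Y) ^ 2 / τ := by
      field_simp; ring
    have : 0 ≤ (τ * X / 2 - Y) ^ 2 / τ := by positivity
    linarith
  rw [Finset.sum_add_distrib, ← Finset.mul_sum, ← Finset.sum_div, ← Finset.sum_div] at h4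
  have h5 : (∑ a, advantage γ τ R P V π s a ^ 2) / τ
      ≤ (∑ s, ∑ a, advantage γ τ R P V π s a ^ 2) / τ := by
    gcongr
    exact Finset.single_le_sum (f := fun s => ∑ a, advantage γ τ R P V π s a ^ 2)
      (fun s _ => Finset.sum_nonneg fun a _ => sq_nonneg _) (Finset.mem_univ s)
  rw [h3]
  linarith

end MDP

/-! ### The optimal policy -/

section Optimal

variable {S A : Type*} [Fintype S] [Fintype A] [Nonempty A]

/-- The log-sum-exp function with temperature `τ`. -/
noncomputable def logSumExp (τ : ℝ) (v : A → ℝ) : ℝ := τ * Real.log (∑ a, Real.exp (v a / τ))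

lemma logSumExp_le_add {τ : ℝ} (hτ : 0 < τ) {v w : A → ℝ} {c : ℝ} (h : ∀ a, v a ≤ w a + c) :
    logSumExp τ v ≤ logSumExp τ w + c := by
  have h1 : ∑ a, Real.exp (v a / τ) ≤ (∑ a, Real.exp (w a / τ)) * Real.exp (c / τ) := by
    rw [Finset.sum_mul]
    refine Finset.sum_le_sum fun a _ => ?_
    rw [← Real.exp_add, ← add_div]
    exact Real.exp_le_exp.2 (by gcongr; exact h a)
  have h2 := Real.log_le_log (sum_exp_pos _) h1
  rw [Real.log_mul (sum_exp_pos _).ne' (Real.exp_pos _).ne', Real.log_exp] at h2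
  have h3 := mul_le_mul_of_nonneg_left h2 hτ.le
  rw [mul_add, mul_div_cancel₀ _ hτ.ne'] at h3
  exact h3

lemma abs_logSumExp_sub_le {τ : ℝ} (hτ : 0 < τ) {v w : A → ℝ} {c : ℝ} (h : ∀ a, |v a - w a| ≤ c) :
    |logSumExp τ v - logSumExp τ w| ≤ c := by
  rw [abs_le]
  constructor
  · have := logSumExp_le_add hτ (v := w) (w := v) (c := c) fun a => by
      have := neg_le_of_abs_le (h a); linarith
    linarith
  · have := logSumExp_le_add hτ (v := v) (w := w) (c := c) fun a => by
      have := le_of_abs_le (h a); linarith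
    linarith

/-- A bound for the optimal values of all problems whose rewards are bounded by `K`. -/
noncomputable def valueBound (A : Type*) [Fintype A] (γ τ K : ℝ) : ℝ :=
  (K + τ * Real.log (Fintype.card A)) / (1 - γ)

/-- The soft Bellman optimality equation has a bounded solution. -/
lemma exists_logSumExp_fixedPoint {γ τ K : ℝ} (hγ0 : 0 < γ) (hγ1 : γ < 1) (hτ : 0 < τ)
    {R : S → A → ℝ} (P : S → A → stdSimplex ℝ S) (hR : ∀ s a, |R s a| ≤ K) :
    ∃ V : S → ℝ, (∀ s, V s = logSumExp τ (qValue γ R P V s)) ∧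
      ∀ s a, |qValue γ R P V s a| ≤ valueBound A γ τ K := by
  set T : (S → ℝ) → S → ℝ := fun V s => logSumExp τ (qValue γ R P V s) with hT
  have hcontr : ContractingWith ⟨γ, hγ0.le⟩ T := by
    refine ⟨by exact_mod_cast hγ1, LipschitzWith.of_dist_le_mul fun V W => ?_⟩
    refine (dist_pi_le_iff (by positivity)).2 fun s => ?_
    rw [Real.dist_eq]
    refine abs_logSumExp_sub_le hτ fun a => ?_
    have e : qValue γ R P V s a - qValue γ R P W s a
        = γ * ∑ s', (P s a).1 s' * (V s' - W s') := by
      simp only [qValue, mul_sub, Finset.sum_sub_distrib]; ring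
    rw [e, abs_mul, abs_of_pos hγ0]
    refine mul_le_mul_of_nonneg_left (simplex_abs_sum_le _ fun s' => ?_) hγ0.le
    rw [← Real.dist_eq]
    exact dist_le_pi_dist V W s'
  have hfix := hcontr.fixedPoint_isFixedPt
  set V := hcontr.fixedPoint T with hV
  have hfix' : ∀ s, V s = logSumExp τ (qValue γ R P V s) := fun s => (congrFun hfix s).symm
  refine ⟨V, hfix', fun s a => ?_⟩
  have : Nonempty S := ⟨s⟩
  obtain ⟨s₀, hs₀⟩ := Finite.exists_max fun s => |V s|
  have hq : ∀ s a, |qValue γ R P V s a| ≤ K + γ * |V s₀| := fun s a =>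
    calc |qValue γ R P V s a| ≤ |R s a| + |γ * ∑ s', (P s a).1 s' * V s'| := abs_add_le _ _
      _ ≤ K + γ * |V s₀| := by
        rw [abs_mul, abs_of_pos hγ0]
        exact add_le_add (hR s a)
          (mul_le_mul_of_nonneg_left (simplex_abs_sum_le _ hs₀) hγ0.le)
  have h0 : logSumExp τ (fun _ : A => (0 : ℝ)) = τ * Real.log (Fintype.card A) := by
    simp [logSumExp]
  have hlog : 0 ≤ τ * Real.log (Fintype.card A) :=
    mul_nonneg hτ.le (Real.log_natCast_nonneg _)
  have hb : |V s₀| ≤ K + γ * |V s₀| + τ * Real.log (Fintype.card A) := by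
    have h1 := abs_logSumExp_sub_le hτ (v := qValue γ R P V s₀) (w := fun _ => 0)
      (c := K + γ * |V s₀|) fun a => by simpa using hq s₀ a
    rw [h0, ← hfix' s₀] at h1
    have h2 := abs_sub_abs_le_abs_sub (V s₀) (τ * Real.log (Fintype.card A))
    rw [abs_of_nonneg hlog] at h2
    linarith
  have hV0 : |V s₀| ≤ valueBound A γ τ K := by
    rw [valueBound, le_div_iff₀ (by linarith)]
    linarith
  have hle : K + γ * |V s₀| ≤ valueBound A γ τ K := by
    have e : valueBound A γ τ K = K + τ * Real.log (Fintype.card A) + γ * valueBound A γ τ K := by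
      have : 1 - γ ≠ 0 := by linarith
      rw [valueBound]; field_simp; ring
    have := mul_le_mul_of_nonneg_left hV0 hγ0.le
    linarith
  exact (hq s a).trans hle

/-- A bound for the norm of the optimal logits. -/
noncomputable def logitRadius (S A : Type*) [Fintype S] [Fintype A] (γ τ K : ℝ) : ℝ :=
  √(Fintype.card (S × A) * (2 * valueBound A γ τ K / τ) ^ 2)

/-- The logits which have mean zero in every state; every policy is represented by a unique such
parameter. -/
def centered (S A : Type*) [Fintype S] [Fintype A] : Submodule ℝ (Param S A) where
  carrier := {w | ∀ s, ∑ a, w (s, a) = 0}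
  add_mem' {u v} hu hv s := by simp [Finset.sum_add_distrib, hu s, hv s]
  zero_mem' s := by simp
  smul_mem' c w hw s := by simp [← Finset.mul_sum, hw s]

/-- There is an optimal policy, given by centred logits of bounded norm, and every other policy
loses at least its relative entropy to the optimal one. -/
theorem exists_optimal_logits {γ τ K : ℝ} (hγ0 : 0 < γ) (hγ1 : γ < 1) (hτ : 0 < τ)
    {R : S → A → ℝ} (P : S → A → stdSimplex ℝ S) (hR : ∀ s a, |R s a| ≤ K) :
    ∃ w ∈ centered S A, ‖w‖ ≤ logitRadius S A γ τ K ∧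
      ∀ V, IsSoftValue γ τ R P (policy w) V →
        ∀ π' V', IsSoftValue γ τ R P π' V' →
          ∀ s, V' s + τ * relEntropy (π' s) (policy w s) ≤ V s := by
  obtain ⟨U, hU, hQ⟩ := exists_logSumExp_fixedPoint hγ0 hγ1 hτ P hR
  set Q := qValue γ R P U with hQdef
  have hn : (0 : ℝ) < Fintype.card A := by exact_mod_cast Fintype.card_pos
  set m : S → ℝ := fun s => (∑ a, Q s a) / Fintype.card A with hm
  set w : Param S A := WithLp.toLp 2 fun i => (Q i.1 i.2 - m i.1) / τ with hw
  have hwa : ∀ s a, w (s, a) = Q s a / τ - m s / τ := fun s a => sub_div _ _ _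
  have hpol : ∀ s, policy w s = softmax fun a => Q s a / τ := by
    intro s
    rw [policy, ← softmax_sub_const (fun a => Q s a / τ) (m s / τ)]
    simp only [hwa]
  have hlog : ∀ s a, τ * Real.log ((policy w s).1 a) = Q s a - U s := by
    intro s a
    rw [hpol, log_softmax, hU s, logSumExp, mul_sub, mul_div_cancel₀ _ hτ.ne']
  -- All actions are equally good for the optimal policy, so only the relative entropy is left of
  -- the gain of another policy.
  have hadv : ∀ s a, advantage γ τ R P U (policy w) s a = 0 := by
    intro s a
    rw [advantage, hlog]; ring
  have hgain : ∀ (π' : S → stdSimplex ℝ A) s,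
      gain γ τ R P U π' s = - (τ * relEntropy (π' s) (policy w s)) := by
    intro π' s
    rw [gain_eq U (policy w) π' s]
    simp [hadv]
  have hpos : ∀ (π' : S → stdSimplex ℝ A) s, 0 ≤ τ * relEntropy (π' s) (policy w s) :=
    fun π' s => mul_nonneg hτ.le (relEntropy_nonneg _ _ (softmax_pos _))
  refine ⟨w, fun s => ?_, ?_, fun V hV π' V' hV' s => ?_⟩
  · simp only [hwa, Finset.sum_sub_distrib, ← Finset.sum_div]
    simp only [Finset.sum_const, Finset.card_univ, nsmul_eq_mul, hm]
    field_simp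
    ring
  · have hb : ∀ i, ‖w i‖ ≤ 2 * valueBound A γ τ K / τ := by
      rintro ⟨s, a⟩
      have h1 : |m s| ≤ valueBound A γ τ K := by
        rw [hm]
        simp only
        rw [abs_div, abs_of_pos hn, div_le_iff₀ hn]
        calc |∑ a, Q s a| ≤ ∑ a, |Q s a| := Finset.abs_sum_le_sum_abs _ _
          _ ≤ ∑ _a : A, valueBound A γ τ K := Finset.sum_le_sum fun a _ => hQ s a
          _ = _ := by simp [mul_comm]
      have e : w (s, a) = (Q s a - m s) / τ := rfl
      rw [e, Real.norm_eq_abs, abs_div, abs_of_pos hτ]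
      gcongr
      have := abs_sub (Q s a) (m s)
      have := hQ s a
      linarith
    rw [EuclideanSpace.norm_eq, logitRadius]
    refine Real.sqrt_le_sqrt ?_
    calc ∑ i, ‖w i‖ ^ 2 ≤ ∑ _i : S × A, (2 * valueBound A γ τ K / τ) ^ 2 :=
          Finset.sum_le_sum fun i _ => by gcongr; exact hb i
      _ = _ := by simp
  · have h1 := le_of_poisson hγ0 hγ1 (U := fun s => V' s - U s) (value_sub_eq hV' U)
      (fun s => by rw [hgain]; linarith [hpos π' s]) s
    have h2 := ge_of_poisson hγ0 hγ1 (U := fun s => V s - U s) (value_sub_eq hV U)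
      (fun s => by rw [hgain, relEntropy_self]; simp) s
    rw [hgain] at h1
    rw [hgain, relEntropy_self] at h2
    linarith

end Optimal

/-! ### The gradient of the discounted reward -/

lemma norm_gradient_sq_eq {S A : Type*} [Fintype S] [Fintype A] [DecidableEq S]
    [DecidableEq A] (J : Param S A → ℝ) (φ : Param S A) :
    ‖gradient J φ‖ ^ 2 = ∑ s, ∑ a, |fderiv ℝ J φ (EuclideanSpace.single (s, a) 1)| ^ 2 := by
  rw [EuclideanSpace.norm_sq_eq, Fintype.sum_prod_type]
  refine Finset.sum_congr rfl fun s _ => Finset.sum_congr rfl fun a _ => ?_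
  have h : inner ℝ (gradient J φ) (EuclideanSpace.single (s, a) (1 : ℝ))
      = fderiv ℝ J φ (EuclideanSpace.single (s, a) 1) := by
    simp [gradient]
  rw [← h, EuclideanSpace.inner_single_right]
  simp

section Gradient

variable {S A : Type*} [Fintype S] [Fintype A] [Nonempty A]
  {γ τ : ℝ} {R : S → A → ℝ} {P : S → A → stdSimplex ℝ S}

lemma abs_deriv_ge_of_abs_ge {f g : ℝ → ℝ} {f' g' c : ℝ} (hf : HasDerivAt f f' 0)
    (hg : HasDerivAt g g' 0) (hg0 : g 0 = 0) (h : ∀ t, c * |g t| ≤ |f t - f 0|) :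
    c * |g'| ≤ |f'| := by
  rw [hasDerivAt_iff_tendsto_slope] at hf hg
  refine le_of_tendsto_of_tendsto' (hg.abs.const_mul c) hf.abs fun t => ?_
  simp only [slope, sub_zero, hg0, vsub_eq_sub, smul_eq_mul, abs_mul]
  rw [mul_left_comm]
  exact mul_le_mul_of_nonneg_left (h t) (abs_nonneg _)

/-- Moving a single logit changes the discounted reward at least by the gain at that state,
weighted with the initial distribution: the discounted visitation frequency dominates the latter. -/
lemma abs_partialDeriv_ge [DecidableEq S] [DecidableEq A] (hγ0 : 0 < γ) (hγ1 : γ < 1) {ρ : S → ℝ}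
    (hρ : ∀ s, 0 ≤ ρ s) {V : Param S A → S → ℝ}
    (hV : ∀ φ, IsSoftValue γ τ R P (policy φ) (V φ)) {φ : Param S A}
    (hd : DifferentiableAt ℝ (fun φ => ∑ s, ρ s * V φ s) φ) (s : S) (a : A) :
    ρ s * |(policy φ s).1 a * advantage γ τ R P (V φ) (policy φ) s a|
      ≤ |fderiv ℝ (fun φ => ∑ s, ρ s * V φ s) φ (EuclideanSpace.single (s, a) 1)| := by
  set J : Param S A → ℝ := fun φ => ∑ s, ρ s * V φ s with hJ
  set e : Param S A := EuclideanSpace.single (s, a) 1 with he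
  have hcurve : HasDerivAt (fun t : ℝ => φ + t • e) e 0 := by
    simpa using ((hasDerivAt_id (0 : ℝ)).smul_const e).const_add φ
  have hf : HasDerivAt (fun t : ℝ => J (φ + t • e)) (fderiv ℝ J φ e) 0 := by
    have h0 : HasFDerivAt J (fderiv ℝ J φ) (φ + (0 : ℝ) • e) := by simpa using hd.hasFDerivAt
    exact h0.comp_hasDerivAt 0 hcurve
  set v : A → ℝ := fun a => φ (s, a) with hv
  have hpol : ∀ t : ℝ, policy (φ + t • e) s
      = softmax fun a' => v a' + if a' = a then t else 0 := by
    intro t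
    rw [policy]
    congr 1
    funext a'
    simp [he, hv]
  have hpol' : ∀ (t : ℝ) s', s' ≠ s → policy (φ + t • e) s' = policy φ s' := by
    intro t s' hs'
    rw [policy, policy]
    congr 1
    funext a'
    simp [he, hs']
  have hg := hasDerivAt_perturb_gain v a τ (advantage γ τ R P (V φ) (policy φ) s a)
  refine abs_deriv_ge_of_abs_ge hf hg (by simp [partitionRatio]) fun t => ?_
  set ξ := (softmax v).1 a * (Real.exp t - 1) * advantage γ τ R P (V φ) (policy φ) s a
    / partitionRatio v a t - τ * (t * ((softmax v).1 a * Real.exp t / partitionRatio v a t)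
      - Real.log (partitionRatio v a t)) with hξ
  -- The perturbed policy differs from the original one in the state `s` only.
  have hgain : ∀ s', gain γ τ R P (V φ) (policy (φ + t • e)) s' = if s' = s then ξ else 0 := by
    intro s'
    rw [gain_eq (V φ) (policy φ)]
    split_ifs with hs
    · subst hs
      have hz := sum_mul_advantage_self (hV φ) s'
      rw [hpol]
      change ∑ a', (softmax v).1 a' * _ = 0 at hz
      rw [sum_softmax_perturb_mul v a t _ hz]
      change _ - τ * relEntropy _ (softmax v) = _
      rw [relEntropy_perturb]
    · rw [hpol' t s' hs, sum_mul_advantage_self (hV φ), relEntropy_self]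
      simp
  have hU := fun s' => value_sub_eq (hV (φ + t • e)) (V φ) s'
  have hdiff : J (φ + t • e) - J (φ + (0 : ℝ) • e)
      = ∑ s', ρ s' * (V (φ + t • e) s' - V φ s') := by
    simp [hJ, mul_sub]
  have hsupp : ∑ s', ρ s' * (if s' = s then ξ else 0) = ρ s * ξ := by simp
  rw [hdiff]
  rcases le_total 0 ξ with h | h
  · have h1 := ge_of_poisson hγ0 hγ1 (U := fun s => V (φ + t • e) s - V φ s) hU
      (fun s' => by rw [hgain]; split_ifs <;> simp [h])
    have h2 : ρ s * ξ ≤ ∑ s', ρ s' * (V (φ + t • e) s' - V φ s') := by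
      rw [← hsupp]
      refine Finset.sum_le_sum fun s' _ => mul_le_mul_of_nonneg_left ?_ (hρ s')
      rw [← hgain]
      exact h1 s'
    rw [abs_of_nonneg h]
    exact h2.trans (le_abs_self _)
  · have h1 := le_of_poisson hγ0 hγ1 (U := fun s => V (φ + t • e) s - V φ s) hU
      (fun s' => by rw [hgain]; split_ifs <;> simp [h])
    have h2 : ∑ s', ρ s' * (V (φ + t • e) s' - V φ s') ≤ ρ s * ξ := by
      rw [← hsupp]
      refine Finset.sum_le_sum fun s' _ => mul_le_mul_of_nonneg_left ?_ (hρ s')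
      rw [← hgain]
      exact h1 s'
    rw [abs_of_nonpos h]
    have := neg_le_abs (∑ s', ρ s' * (V (φ + t • e) s' - V φ s'))
    linarith

/-- The Polyak–Łojasiewicz inequality for the discounted reward of a single player. -/
theorem discounted_reward_PL (hγ0 : 0 < γ) (hγ1 : γ < 1) (hτ : 0 < τ) {ρ : stdSimplex ℝ S}
    {δρ δ : ℝ} (hδρ : 0 < δρ) (hδ : 0 < δ) (hρ : ∀ s, δρ ≤ ρ.1 s) {V : Param S A → S → ℝ}
    (hV : ∀ φ, IsSoftValue γ τ R P (policy φ) (V φ)) {φ : Param S A}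
    (hφ : ∀ s a, δ ≤ (policy φ s).1 a)
    (hd : DifferentiableAt ℝ (fun φ => ∑ s, ρ.1 s * V φ s) φ) (φ' : Param S A) :
    δρ ^ 2 * δ ^ 2 * (1 - γ) * τ *
        ((∑ s, ρ.1 s * V φ' s) - ∑ s, ρ.1 s * V φ s)
      ≤ ‖gradient (fun φ => ∑ s, ρ.1 s * V φ s) φ‖ ^ 2 := by
  classical
  set D := ∑ s, ∑ a, advantage γ τ R P (V φ) (policy φ) s a ^ 2 with hD
  have h1 : (∑ s, ρ.1 s * V φ' s) - ∑ s, ρ.1 s * V φ s ≤ D / τ / (1 - γ) := by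
    rw [← Finset.sum_sub_distrib]
    simp only [← mul_sub]
    exact simplex_sum_le ρ fun s => value_sub_le hγ0 hγ1 hτ (fun s a => hδ.trans_le (hφ s a))
      (hV φ) (hV φ') s
  have h2 : δρ ^ 2 * δ ^ 2 * D ≤ ‖gradient (fun φ => ∑ s, ρ.1 s * V φ s) φ‖ ^ 2 := by
    rw [norm_gradient_sq_eq, hD]
    simp only [Finset.mul_sum]
    refine Finset.sum_le_sum fun s _ => Finset.sum_le_sum fun a _ => ?_
    have h3 := abs_partialDeriv_ge hγ0 hγ1 (fun s => ρ.2.1 s) hV hd s a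
    rw [← mul_pow, ← sq_abs (advantage γ τ R P (V φ) (policy φ) s a), ← mul_pow]
    refine pow_le_pow_left₀ (by positivity) (le_trans ?_ h3) 2
    rw [abs_mul, abs_of_pos (hδ.trans_le (hφ s a)), mul_assoc]
    exact mul_le_mul (hρ s) (mul_le_mul_of_nonneg_right (hφ s a) (abs_nonneg _)) (by positivity)
      (ρ.2.1 s)
  have hγ' : 0 < 1 - γ := by linarith
  calc _ ≤ δρ ^ 2 * δ ^ 2 * (1 - γ) * τ * (D / τ / (1 - γ)) := by gcongr
    _ = δρ ^ 2 * δ ^ 2 * D := by field_simp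
    _ ≤ _ := h2

end Gradient

/-! ### Value functions of parametric maximisation problems -/

section ParametricMax

open Filter Topology

variable {E Z W : Type*} [NormedAddCommGroup E] [NormedSpace ℝ E] [NormedAddCommGroup Z]
  [NormedSpace ℝ Z] [NormedAddCommGroup W] [NormedSpace ℝ W]

/-- `f` is twice differentiable, with an `L₁`-Lipschitz first derivative and an `L₂`-Lipschitz
second derivative. -/
structure LipschitzDerivs (L₁ L₂ : ℝ) (f : E → ℝ) : Prop where
  differentiable : Differentiable ℝ f
  differentiable_fderiv : Differentiable ℝ (fderiv ℝ f)
  lip_fderiv : ∀ p q, ‖fderiv ℝ f p - fderiv ℝ f q‖ ≤ L₁ * ‖p - q‖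
  lip_fderiv_fderiv : ∀ p q, ‖fderiv ℝ (fderiv ℝ f) p - fderiv ℝ (fderiv ℝ f) q‖ ≤ L₂ * ‖p - q‖

lemma LipschitzDerivs.add {L₁ L₂ K₁ K₂ : ℝ} {f g : E → ℝ} (hf : LipschitzDerivs L₁ L₂ f)
    (hg : LipschitzDerivs K₁ K₂ g) : LipschitzDerivs (L₁ + K₁) (L₂ + K₂) (fun p => f p + g p) := by
  have h1 : fderiv ℝ (fun p => f p + g p) = fun p => fderiv ℝ f p + fderiv ℝ g p :=
    funext fun p => fderiv_fun_add (hf.differentiable p) (hg.differentiable p)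
  have h2 : fderiv ℝ (fun p => fderiv ℝ f p + fderiv ℝ g p)
      = fun p => fderiv ℝ (fderiv ℝ f) p + fderiv ℝ (fderiv ℝ g) p :=
    funext fun p => fderiv_fun_add (hf.differentiable_fderiv p) (hg.differentiable_fderiv p)
  refine ⟨hf.differentiable.add hg.differentiable, ?_, fun p q => ?_, fun p q => ?_⟩
  · rw [h1]; exact hf.differentiable_fderiv.add hg.differentiable_fderiv
  · rw [h1, add_sub_add_comm, add_mul]
    exact norm_add_le_of_le (hf.lip_fderiv p q) (hg.lip_fderiv p q)
  · rw [h1, h2, add_sub_add_comm, add_mul]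
    have h3 := hf.lip_fderiv_fderiv p q
    have h4 := hg.lip_fderiv_fderiv p q
    have h5 := norm_add_le (fderiv ℝ (fderiv ℝ f) p - fderiv ℝ (fderiv ℝ f) q)
      (fderiv ℝ (fderiv ℝ g) p - fderiv ℝ (fderiv ℝ g) q)
    linarith

lemma LipschitzDerivs.neg {L₁ L₂ : ℝ} {f : E → ℝ} (hf : LipschitzDerivs L₁ L₂ f) :
    LipschitzDerivs L₁ L₂ (fun p => - f p) := by
  have h1 : fderiv ℝ (fun p => - f p) = fun p => - fderiv ℝ f p :=
    funext fun p => fderiv_fun_neg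
  have h2 : fderiv ℝ (fun p => - fderiv ℝ f p) = fun p => - fderiv ℝ (fderiv ℝ f) p :=
    funext fun p => fderiv_fun_neg
  refine ⟨hf.differentiable.neg, ?_, fun p q => ?_, fun p q => ?_⟩
  · rw [h1]; exact hf.differentiable_fderiv.neg
  · rw [h1, neg_sub_neg, norm_sub_rev p q]
    exact hf.lip_fderiv q p
  · rw [h1, h2, neg_sub_neg, norm_sub_rev p q]
    exact hf.lip_fderiv_fderiv q p

/-- For every `z`, the function `w ↦ f (A z + B w)` has its maximum over the ball of radius `r + 1`
at the point `y z` of the ball of radius `r`, and it falls off quadratically. -/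
structure IsQuadraticArgmax (f : E → ℝ) (A : Z →L[ℝ] E) (B : W →L[ℝ] E) (c r : ℝ) (y : Z → W) :
    Prop where
  pos : 0 < c
  norm_left : ∀ z, ‖A z‖ ≤ ‖z‖
  norm_right : ∀ w, ‖B w‖ ≤ ‖w‖
  norm_le : ∀ z, ‖y z‖ ≤ r
  growth : ∀ z w, ‖w‖ ≤ r + 1 → f (A z + B w) + c * ‖w - y z‖ ^ 2 ≤ f (A z + B (y z))

variable {f : E → ℝ} {A : Z →L[ℝ] E} {B : W →L[ℝ] E} {c r L₁ L₂ : ℝ} {y : Z → W}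

lemma deriv_deriv_nonpos_of_isLocalMax {φ φ' : ℝ → ℝ} {s : ℝ} (hφ : ∀ t, HasDerivAt φ (φ' t) t)
    (hφ' : HasDerivAt φ' s 0) (hmax : IsLocalMax φ 0) : s ≤ 0 := by
  have hd : deriv φ = φ' := funext fun t => (hφ t).deriv
  -- Otherwise `0` is a local minimum as well, so `φ` is locally constant.
  by_contra! hs
  have hmin : IsLocalMin φ 0 := by
    refine isLocalMin_of_deriv_deriv_pos ?_ hmax.deriv_eq_zero (hφ 0).continuousAt
    rw [hd, hφ'.deriv]; exact hs
  have hconst : φ =ᶠ[𝓝 0] fun _ => φ 0 := by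
    filter_upwards [hmin, hmax] with t h1 h2 using le_antisymm h2 h1
  have h0 : φ' =ᶠ[𝓝 0] fun _ => 0 := by
    have := hconst.deriv
    rw [hd] at this
    simpa using this
  have := h0.deriv_eq
  rw [hφ'.deriv] at this
  simp at this
  linarith

namespace IsQuadraticArgmax

lemma hasFDerivAt_comp_affine (hf : LipschitzDerivs L₁ L₂ f) (B : W →L[ℝ] E) (p : E) (w : W) :
    HasFDerivAt (fun w => f (p + B w)) ((fderiv ℝ f (p + B w)).comp B) w :=
  (hf.differentiable (p + B w)).hasFDerivAt.comp w (B.hasFDerivAt.const_add p)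

/-- The maximiser is a Lipschitz function of the parameter. -/
lemma lipschitz (h : IsQuadraticArgmax f A B c r y) (hL₁ : 0 ≤ L₁) (hf : LipschitzDerivs L₁ L₂ f)
    (z z' : Z) : ‖y z - y z'‖ ≤ L₁ / (2 * c) * ‖z - z'‖ := by
  have hc := h.pos
  have g1 := h.growth z (y z') ((h.norm_le z').trans (by linarith))
  have g2 := h.growth z' (y z) ((h.norm_le z).trans (by linarith))
  rw [norm_sub_rev (y z')] at g1
  -- The sum of the growth conditions at `z` and at `z'` bounds `2 c ‖y z - y z'‖ ^ 2` by an
  -- increment of `w ↦ f (A z + B w) - f (A z' + B w)`, which is `L₁ ‖z - z'‖`-Lipschitz.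
  have hk : ∀ w, HasFDerivWithinAt (fun w => f (A z + B w) - f (A z' + B w))
      ((fderiv ℝ f (A z + B w)).comp B - (fderiv ℝ f (A z' + B w)).comp B) Set.univ w := fun w =>
    ((hasFDerivAt_comp_affine hf B _ w).sub (hasFDerivAt_comp_affine hf B _ w)).hasFDerivWithinAt
  have hb : ∀ w, ‖(fderiv ℝ f (A z + B w)).comp B - (fderiv ℝ f (A z' + B w)).comp B‖
      ≤ L₁ * ‖z - z'‖ := by
    intro w
    rw [← ContinuousLinearMap.sub_comp]
    have hB : ‖B‖ ≤ 1 := B.opNorm_le_bound zero_le_one fun w => by simpa using h.norm_right w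
    calc _ ≤ ‖fderiv ℝ f (A z + B w) - fderiv ℝ f (A z' + B w)‖ * ‖B‖ :=
          ContinuousLinearMap.opNorm_comp_le _ _
      _ ≤ ‖fderiv ℝ f (A z + B w) - fderiv ℝ f (A z' + B w)‖ * 1 := by gcongr
      _ ≤ L₁ * ‖A z + B w - (A z' + B w)‖ := by rw [mul_one]; exact hf.lip_fderiv _ _
      _ ≤ L₁ * ‖z - z'‖ := by
        rw [add_sub_add_right_eq_sub, ← map_sub]
        gcongr
        exact h.norm_left _
  have hm := convex_univ.norm_image_sub_le_of_norm_hasFDerivWithin_le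
    (fun w _ => hk w) (fun w _ => hb w) (Set.mem_univ (y z')) (Set.mem_univ (y z))
  have hm' := (le_abs_self _).trans hm
  rw [div_mul_eq_mul_div, le_div_iff₀ (by positivity)]
  rcases (norm_nonneg (y z - y z')).eq_or_lt with h0 | h0
  · rw [← h0, zero_mul]; positivity
  · refine le_of_mul_le_mul_right ?_ h0
    nlinarith

/-- The first-order condition at the maximiser. -/
lemma fderiv_comp_eq_zero (h : IsQuadraticArgmax f A B c r y) (hf : LipschitzDerivs L₁ L₂ f)
    (z : Z) (w : W) : fderiv ℝ f (A z + B (y z)) (B w) = 0 := by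
  have hmax : IsLocalMax (fun w => f (A z + B w)) (y z) := by
    filter_upwards [Metric.ball_mem_nhds (y z) one_pos] with w hw
    rw [mem_ball_iff_norm] at hw
    have h1 : ‖w‖ ≤ r + 1 := by
      have := norm_le_norm_add_norm_sub' w (y z)
      linarith [h.norm_le z]
    have h2 := h.growth z w h1
    have h3 : 0 ≤ c * ‖w - y z‖ ^ 2 := mul_nonneg h.pos.le (sq_nonneg _)
    linarith
  exact DFunLike.congr_fun (hmax.hasFDerivAt_eq_zero (hasFDerivAt_comp_affine hf B _ (y z))) w

/-- The Hessian of `w ↦ f (A z + B w)` at the maximiser is negative definite. -/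
lemma coercive (h : IsQuadraticArgmax f A B c r y) (hf : LipschitzDerivs L₁ L₂ f) (z : Z) (v : W) :
    2 * c * ‖v‖ ^ 2 ≤ - fderiv ℝ (fderiv ℝ f) (A z + B (y z)) (B v) (B v) := by
  set p := A z + B (y z) with hp
  have hcurve : ∀ t : ℝ, HasDerivAt (fun t : ℝ => p + t • B v) (B v) t := fun t => by
    simpa using ((hasDerivAt_id t).smul_const (B v)).const_add p
  have h1 : ∀ t : ℝ, HasDerivAt (fun t : ℝ => f (p + t • B v) + c * ‖v‖ ^ 2 * t ^ 2)
      (fderiv ℝ f (p + t • B v) (B v) + c * ‖v‖ ^ 2 * (2 * t)) t := fun t => by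
    have h2 := (hasDerivAt_pow 2 t).const_mul (c * ‖v‖ ^ 2)
    exact ((hf.differentiable _).hasFDerivAt.comp_hasDerivAt t (hcurve t)).add
      (by simpa using h2)
  have h2 : HasDerivAt (fun t : ℝ => fderiv ℝ f (p + t • B v) (B v) + c * ‖v‖ ^ 2 * (2 * t))
      (fderiv ℝ (fderiv ℝ f) p (B v) (B v) + c * ‖v‖ ^ 2 * (2 * 1)) 0 := by
    have h0 : HasFDerivAt (fderiv ℝ f) (fderiv ℝ (fderiv ℝ f) p) (p + (0 : ℝ) • B v) := by
      simpa using (hf.differentiable_fderiv p).hasFDerivAt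
    have h3 := (ContinuousLinearMap.apply ℝ ℝ (B v)).hasFDerivAt.comp_hasDerivAt 0
      (h0.comp_hasDerivAt 0 (hcurve 0))
    exact HasDerivAt.add h3 (((hasDerivAt_id (0 : ℝ)).const_mul 2).const_mul _)
  -- Quadratic growth says that adding `c ‖v‖ ^ 2 t ^ 2` does not destroy the maximum at `t = 0`.
  have hmax : IsLocalMax (fun t : ℝ => f (p + t • B v) + c * ‖v‖ ^ 2 * t ^ 2) 0 := by
    have hcont : Tendsto (fun t : ℝ => ‖t • v‖) (𝓝 0) (𝓝 0) := by
      have : Continuous fun t : ℝ => ‖t • v‖ := by fun_prop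
      simpa using this.tendsto 0
    filter_upwards [hcont.eventually (gt_mem_nhds one_pos)] with t ht
    have h3 : ‖y z + t • v‖ ≤ r + 1 := (norm_add_le _ _).trans (add_le_add (h.norm_le z) ht.le)
    have h4 := h.growth z (y z + t • v) h3
    rw [add_sub_cancel_left, norm_smul, mul_pow, Real.norm_eq_abs, sq_abs, map_add, map_smul,
      ← add_assoc] at h4
    simp only [zero_smul, add_zero]
    linarith
  have := deriv_deriv_nonpos_of_isLocalMax h1 h2 hmax
  linarith

lemma norm_point_sub_le (h : IsQuadraticArgmax f A B c r y) (hL₁ : 0 ≤ L₁)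
    (hf : LipschitzDerivs L₁ L₂ f) (z z' : Z) :
    ‖A z + B (y z) - (A z' + B (y z'))‖ ≤ (1 + L₁ / (2 * c)) * ‖z - z'‖ := by
  have e : A z + B (y z) - (A z' + B (y z')) = A (z - z') + B (y z - y z') := by
    simp only [map_sub]; abel
  rw [e, add_mul, one_mul]
  exact norm_add_le_of_le (h.norm_left _) ((h.norm_right _).trans (h.lipschitz hL₁ hf _ _))

variable [FiniteDimensional ℝ W]

/-- The derivative of the maximiser, as the solution of the linearised first-order condition. -/
lemma exists_derivative (h : IsQuadraticArgmax f A B c r y) (hf : LipschitzDerivs L₁ L₂ f)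
    (z : Z) : ∃ D : Z →L[ℝ] W, ∀ u w,
      fderiv ℝ (fderiv ℝ f) (A z + B (y z)) (A u + B (D u)) (B w) = 0 := by
  set F := fderiv ℝ (fderiv ℝ f) (A z + B (y z)) with hF
  set R : (E →L[ℝ] ℝ) →L[ℝ] (W →L[ℝ] ℝ) := (ContinuousLinearMap.compL ℝ W E ℝ).flip B with hR
  have hRa : ∀ ℓ w, R ℓ w = ℓ (B w) := fun ℓ w => rfl
  set H : W →L[ℝ] (W →L[ℝ] ℝ) := R.comp (F.comp B) with hH
  have hinj : Function.Injective (H : W →ₗ[ℝ] (W →L[ℝ] ℝ)) := by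
    refine (injective_iff_map_eq_zero _).2 fun v hv => ?_
    have h1 := h.coercive hf z v
    have h2 : F (B v) (B v) = 0 := by
      change H v v = 0
      have hv' : H v = 0 := hv
      rw [hv']; rfl
    rw [← hF, h2] at h1
    have hc := h.pos
    have : ‖v‖ ^ 2 ≤ 0 := by nlinarith
    simpa using this
  have hdim : Module.finrank ℝ W = Module.finrank ℝ (W →L[ℝ] ℝ) := by
    rw [← (LinearMap.toContinuousLinearMap (𝕜 := ℝ) (E := W) (F' := ℝ)).finrank_eq]
    exact Subspace.dual_finrank_eq.symm
  have hsurj := (LinearMap.injective_iff_surjective_of_finrank_eq_finrank hdim).1 hinj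
  let e := (LinearEquiv.ofBijective (H : W →ₗ[ℝ] (W →L[ℝ] ℝ))
    ⟨hinj, hsurj⟩).toContinuousLinearEquiv
  refine ⟨(e.symm : (W →L[ℝ] ℝ) →L[ℝ] W).comp (-(R.comp (F.comp A))), fun u w => ?_⟩
  have h1 : H (e.symm ((-(R.comp (F.comp A))) u)) = (-(R.comp (F.comp A))) u :=
    e.apply_symm_apply _
  have h2 := DFunLike.congr_fun h1 w
  change F (B (e.symm ((-(R.comp (F.comp A))) u))) (B w) = -(F (A u) (B w)) at h2
  rw [map_add, add_apply]
  change F (A u) (B w) + F (B (e.symm ((-(R.comp (F.comp A))) u))) (B w) = 0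
  rw [h2]; ring

/-- The derivative of the maximiser with respect to the parameter. -/
noncomputable def argmaxDeriv (h : IsQuadraticArgmax f A B c r y) (hf : LipschitzDerivs L₁ L₂ f)
    (z : Z) : Z →L[ℝ] W := (h.exists_derivative hf z).choose

lemma argmaxDeriv_spec (h : IsQuadraticArgmax f A B c r y) (hf : LipschitzDerivs L₁ L₂ f)
    (z u : Z) (w : W) : fderiv ℝ (fderiv ℝ f) (A z + B (y z))
      (A u + B (h.argmaxDeriv hf z u)) (B w) = 0 :=
  (h.exists_derivative hf z).choose_spec u w

lemma hasFDerivAt_argmax (h : IsQuadraticArgmax f A B c r y) (hL₁ : 0 ≤ L₁)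
    (hf : LipschitzDerivs L₁ L₂ f) (z : Z) : HasFDerivAt y (h.argmaxDeriv hf z) z := by
  have hc := h.pos
  set D := h.argmaxDeriv hf z with hD
  set P : Z → E := fun z => A z + B (y z) with hP
  set F := fderiv ℝ (fderiv ℝ f) (P z) with hF
  have hPbound : ∀ z', ‖P z' - P z‖ ≤ (1 + L₁ / (2 * c)) * ‖z' - z‖ := by
    intro z'
    have e : P z' - P z = A (z' - z) + B (y z' - y z) := by simp only [hP, map_sub]; abel
    rw [e, add_mul, one_mul]
    exact norm_add_le_of_le (h.norm_left _) ((h.norm_right _).trans (h.lipschitz hL₁ hf _ _))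
  have hPO : (fun z' => P z' - P z) =O[𝓝 z] fun z' => z' - z :=
    Asymptotics.IsBigO.of_bound _ (Eventually.of_forall hPbound)
  have hPt : Tendsto P (𝓝 z) (𝓝 (P z)) := by
    rw [tendsto_iff_norm_sub_tendsto_zero]
    refine squeeze_zero (fun _ => norm_nonneg _) hPbound ?_
    have : Continuous fun z' : Z => (1 + L₁ / (2 * c)) * ‖z' - z‖ := by fun_prop
    simpa using this.tendsto z
  have hrem : (fun z' => fderiv ℝ f (P z') - fderiv ℝ f (P z) - F (P z' - P z))
      =o[𝓝 z] fun z' => z' - z :=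
    (((hf.differentiable_fderiv (P z)).hasFDerivAt.isLittleO).comp_tendsto hPt).trans_isBigO hPO
  -- The Hessian applied to the error `v` of the linear approximation is the Taylor remainder of
  -- the first-order condition, and the Hessian is coercive.
  rw [hasFDerivAt_iff_isLittleO]
  refine Asymptotics.IsBigO.trans_isLittleO
    (Asymptotics.IsBigO.of_bound (1 / (2 * c)) (Eventually.of_forall fun z' => ?_)) hrem
  set v := y z' - y z - D (z' - z) with hv
  set Rm := fderiv ℝ f (P z') - fderiv ℝ f (P z) - F (P z' - P z) with hRm
  have e1 : P z' - P z = A (z' - z) + B (D (z' - z)) + B v := by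
    simp only [hP, hv, map_sub]; abel
  have h1 : F (B v) (B v) = - Rm (B v) := by
    rw [hRm, e1]
    simp only [sub_apply]
    rw [map_add, add_apply, h.argmaxDeriv_spec hf z (z' - z) v,
      h.fderiv_comp_eq_zero hf z', h.fderiv_comp_eq_zero hf z]
    ring
  have h2 := h.coercive hf z v
  rw [← hF, h1, neg_neg] at h2
  have h3 : Rm (B v) ≤ ‖Rm‖ * ‖v‖ :=
    (le_abs_self _).trans ((Rm.le_opNorm _).trans
      (mul_le_mul_of_nonneg_left (h.norm_right v) (norm_nonneg _)))
  rw [one_div, inv_mul_eq_div, le_div_iff₀ (by positivity)]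
  rcases (norm_nonneg v).eq_or_lt with h0 | h0
  · rw [← h0]; simp
  · refine le_of_mul_le_mul_right ?_ h0
    nlinarith

lemma hasFDerivAt_point (h : IsQuadraticArgmax f A B c r y) (hL₁ : 0 ≤ L₁)
    (hf : LipschitzDerivs L₁ L₂ f) (z : Z) :
    HasFDerivAt (fun z => A z + B (y z)) (A + B.comp (h.argmaxDeriv hf z)) z :=
  A.hasFDerivAt.add (B.hasFDerivAt.comp z (h.hasFDerivAt_argmax hL₁ hf z))

/-- The envelope theorem. -/
lemma hasFDerivAt_max (h : IsQuadraticArgmax f A B c r y) (hL₁ : 0 ≤ L₁)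
    (hf : LipschitzDerivs L₁ L₂ f) (z : Z) :
    HasFDerivAt (fun z => f (A z + B (y z))) ((fderiv ℝ f (A z + B (y z))).comp A) z := by
  refine ((hf.differentiable _).hasFDerivAt.comp z (h.hasFDerivAt_point hL₁ hf z)).congr_fderiv ?_
  ext u
  simp [h.fderiv_comp_eq_zero hf z]

lemma norm_argmaxDeriv_le (h : IsQuadraticArgmax f A B c r y) (hL₁ : 0 ≤ L₁)
    (hf : LipschitzDerivs L₁ L₂ f) (z u : Z) :
    ‖h.argmaxDeriv hf z u‖ ≤ L₁ / (2 * c) * ‖u‖ := by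
  have hc := h.pos
  have : ‖h.argmaxDeriv hf z‖ ≤ L₁ / (2 * c) :=
    (h.hasFDerivAt_argmax hL₁ hf z).le_of_lip' (by positivity)
      (Eventually.of_forall fun z' => h.lipschitz hL₁ hf z' z)
  exact (ContinuousLinearMap.le_opNorm _ _).trans (by gcongr)

lemma norm_direction_le (h : IsQuadraticArgmax f A B c r y) (hL₁ : 0 ≤ L₁)
    (hf : LipschitzDerivs L₁ L₂ f) (z u : Z) :
    ‖A u + B (h.argmaxDeriv hf z u)‖ ≤ (1 + L₁ / (2 * c)) * ‖u‖ := by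
  rw [add_mul, one_mul]
  exact norm_add_le_of_le (h.norm_left _)
    ((h.norm_right _).trans (h.norm_argmaxDeriv_le hL₁ hf z u))

/-- The derivative of the maximiser is Lipschitz: subtract the linearised first-order conditions at
`z` and `z'`, and use coercivity. -/
lemma norm_argmaxDeriv_sub_le (h : IsQuadraticArgmax f A B c r y) (hL₁ : 0 ≤ L₁) (hL₂ : 0 ≤ L₂)
    (hf : LipschitzDerivs L₁ L₂ f) (z z' u : Z) :
    ‖h.argmaxDeriv hf z u - h.argmaxDeriv hf z' u‖
      ≤ L₂ * (1 + L₁ / (2 * c)) ^ 2 / (2 * c) * ‖z - z'‖ * ‖u‖ := by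
  have hc := h.pos
  set v := h.argmaxDeriv hf z u - h.argmaxDeriv hf z' u with hv
  set F := fderiv ℝ (fderiv ℝ f) (A z + B (y z)) with hF
  set F' := fderiv ℝ (fderiv ℝ f) (A z' + B (y z')) with hF'
  set m := A u + B (h.argmaxDeriv hf z' u) with hm
  have e : B v = (A u + B (h.argmaxDeriv hf z u)) - m := by rw [hm, hv, map_sub]; abel
  have h1 : - F (B v) (B v) = (F - F') m (B v) := by
    nth_rewrite 1 [e]
    rw [map_sub, sub_apply, h.argmaxDeriv_spec hf z u v,
      sub_apply, sub_apply,
      h.argmaxDeriv_spec hf z' u v]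
    ring
  have h2 := h.coercive hf z v
  rw [← hF, h1] at h2
  have h3 : ‖F - F'‖ ≤ L₂ * ((1 + L₁ / (2 * c)) * ‖z - z'‖) :=
    (hf.lip_fderiv_fderiv _ _).trans (by gcongr; exact h.norm_point_sub_le hL₁ hf z z')
  have h4 : (F - F') m (B v)
      ≤ L₂ * ((1 + L₁ / (2 * c)) * ‖z - z'‖) * ((1 + L₁ / (2 * c)) * ‖u‖) * ‖v‖ := by
    calc (F - F') m (B v) ≤ ‖F - F'‖ * ‖m‖ * ‖B v‖ :=
          (le_abs_self _).trans ((F - F').le_opNorm₂ m (B v))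
      _ ≤ _ := by
        gcongr
        · exact h.norm_direction_le hL₁ hf z' u
        · exact h.norm_right v
  have h5 : L₂ * (1 + L₁ / (2 * c)) ^ 2 / (2 * c) * ‖z - z'‖ * ‖u‖
      = (L₂ * ((1 + L₁ / (2 * c)) * ‖z - z'‖) * ((1 + L₁ / (2 * c)) * ‖u‖)) / (2 * c) := by
    ring
  rw [h5, le_div_iff₀ (by positivity)]
  rcases (norm_nonneg v).eq_or_lt with h0 | h0
  · rw [← h0, zero_mul]; positivity
  · refine le_of_mul_le_mul_right ?_ h0
    nlinarith

/-- The maximal value is as smooth a function of the parameter as `f` itself. -/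
theorem lipschitzDerivs_max (h : IsQuadraticArgmax f A B c r y) (hL₁ : 0 ≤ L₁) (hL₂ : 0 ≤ L₂)
    (hf : LipschitzDerivs L₁ L₂ f) :
    LipschitzDerivs (L₁ * (1 + L₁ / (2 * c))) (L₂ * (1 + L₁ / (2 * c)) ^ 3)
      (fun z => f (A z + B (y z))) := by
  have hc := h.pos
  set κ := 1 + L₁ / (2 * c) with hκ
  have hκ0 : 0 ≤ κ := by positivity
  have hA : ‖A‖ ≤ 1 := A.opNorm_le_bound zero_le_one fun z => by simpa using h.norm_left z
  set R : (E →L[ℝ] ℝ) →L[ℝ] (Z →L[ℝ] ℝ) := (ContinuousLinearMap.compL ℝ Z E ℝ).flip A with hR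
  have hRn : ∀ ℓ, ‖R ℓ‖ ≤ ‖ℓ‖ := fun ℓ =>
    calc ‖R ℓ‖ ≤ ‖ℓ‖ * ‖A‖ := ContinuousLinearMap.opNorm_comp_le ℓ A
      _ ≤ ‖ℓ‖ * 1 := by gcongr
      _ = ‖ℓ‖ := mul_one _
  have h1 : fderiv ℝ (fun z => f (A z + B (y z)))
      = fun z => R (fderiv ℝ f (A z + B (y z))) :=
    funext fun z => (h.hasFDerivAt_max hL₁ hf z).fderiv
  have h2 : ∀ z, HasFDerivAt (fun z => R (fderiv ℝ f (A z + B (y z))))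
      (R.comp ((fderiv ℝ (fderiv ℝ f) (A z + B (y z))).comp
        (A + B.comp (h.argmaxDeriv hf z)))) z := fun z =>
    R.hasFDerivAt.comp z ((hf.differentiable_fderiv _).hasFDerivAt.comp z
      (h.hasFDerivAt_point hL₁ hf z))
  refine ⟨fun z => (h.hasFDerivAt_max hL₁ hf z).differentiableAt, ?_, fun z z' => ?_,
    fun z z' => ?_⟩
  · rw [h1]; exact fun z => (h2 z).differentiableAt
  · rw [h1]
    simp only
    rw [← map_sub, mul_assoc]
    exact (hRn _).trans ((hf.lip_fderiv _ _).trans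
      (by gcongr; exact h.norm_point_sub_le hL₁ hf z z'))
  · rw [h1, (h2 z).fderiv, (h2 z').fderiv]
    refine ContinuousLinearMap.opNorm_le_bound _ (by positivity) fun u => ?_
    set F := fderiv ℝ (fderiv ℝ f) (A z + B (y z)) with hF
    set F' := fderiv ℝ (fderiv ℝ f) (A z' + B (y z')) with hF'
    set m := A u + B (h.argmaxDeriv hf z u) with hm
    set v := h.argmaxDeriv hf z u - h.argmaxDeriv hf z' u with hv
    have e : (R.comp (F.comp (A + B.comp (h.argmaxDeriv hf z)))
        - R.comp (F'.comp (A + B.comp (h.argmaxDeriv hf z')))) u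
        = R ((F - F') m + F' (B v)) := by
      have e' : A u + B (h.argmaxDeriv hf z' u) = m - B v := by rw [hm, hv, map_sub]; abel
      change R (F (A u + B (h.argmaxDeriv hf z u))) - R (F' (A u + B (h.argmaxDeriv hf z' u))) = _
      rw [e', ← map_sub, map_sub F', sub_apply]
      congr 1
      abel
    have hFF : ‖F - F'‖ ≤ L₂ * (κ * ‖z - z'‖) :=
      (hf.lip_fderiv_fderiv _ _).trans (by gcongr; exact h.norm_point_sub_le hL₁ hf z z')
    have hF'n : ‖F'‖ ≤ L₁ := (hf.differentiable_fderiv _).hasFDerivAt.le_of_lip' hL₁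
      (Eventually.of_forall fun p => hf.lip_fderiv p _)
    rw [e]
    calc _ ≤ ‖(F - F') m + F' (B v)‖ := hRn _
      _ ≤ ‖F - F'‖ * ‖m‖ + ‖F'‖ * ‖B v‖ :=
        norm_add_le_of_le ((F - F').le_opNorm m) (F'.le_opNorm (B v))
      _ ≤ L₂ * (κ * ‖z - z'‖) * (κ * ‖u‖)
          + L₁ * (L₂ * κ ^ 2 / (2 * c) * ‖z - z'‖ * ‖u‖) := by
        gcongr
        · exact h.norm_direction_le hL₁ hf z u
        · exact (h.norm_right v).trans (h.norm_argmaxDeriv_sub_le hL₁ hL₂ hf z z' u)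
      _ = L₂ * κ ^ 2 * (1 + L₁ / (2 * c)) * ‖z - z'‖ * ‖u‖ := by ring
      _ = L₂ * κ ^ 3 * ‖z - z'‖ * ‖u‖ := by rw [← hκ]; ring

/-- The derivative of a difference of a maximal and a minimal value. -/
lemma fderiv_max_sub_min {W' : Type*} [NormedAddCommGroup W'] [NormedSpace ℝ W']
    [FiniteDimensional ℝ W'] {A' : Z →L[ℝ] E} {B' : W' →L[ℝ] E} {c' r' : ℝ} {y' : Z → W'}
    (h : IsQuadraticArgmax f A B c r y) (h' : IsQuadraticArgmax (fun p => - f p) A' B' c' r' y')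
    (hL₁ : 0 ≤ L₁) (hf : LipschitzDerivs L₁ L₂ f) (z u : Z) :
    fderiv ℝ (fun z => f (A z + B (y z)) + (- f (A' z + B' (y' z)))) z u
      = fderiv ℝ f (A z + B (y z)) (A u) - fderiv ℝ f (A' z + B' (y' z)) (A' u) := by
  have h1 := (h.hasFDerivAt_max hL₁ hf z).add (h'.hasFDerivAt_max hL₁ hf.neg z)
  rw [fderiv_fun_neg] at h1
  refine (DFunLike.congr_fun h1.fderiv u).trans ?_
  rw [sub_eq_add_neg]
  rfl

end IsQuadraticArgmax

end ParametricMax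

/-! ### Quadratic growth at the best response -/

section BestResponse

variable {S A : Type*} [Fintype S] [Fintype A] [Nonempty A]

/-- A lower bound for the policies of all logits whose norm is at most `r`. -/
noncomputable def policyBound (A : Type*) [Fintype A] (r : ℝ) : ℝ :=
  Real.exp (-(2 * r)) / Fintype.card A

/-- The modulus of quadratic growth of the discounted reward at the best response. -/
noncomputable def growthModulus (S A : Type*) [Fintype S] [Fintype A] (γ τ K δρ : ℝ) : ℝ :=
  δρ * τ * (policyBound A (logitRadius S A γ τ K + 1) ^ 2 / 4)

lemma policyBound_pos (r : ℝ) : 0 < policyBound A r :=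
  div_pos (Real.exp_pos _) (by exact_mod_cast Fintype.card_pos)

lemma growthModulus_pos {γ τ K δρ : ℝ} (hτ : 0 < τ) (hδρ : 0 < δρ) :
    0 < growthModulus S A γ τ K δρ := by
  have := policyBound_pos (A := A) (logitRadius S A γ τ K + 1)
  unfold growthModulus
  positivity

/-- The discounted reward of a single player has a maximiser among the centred logits, where it
grows quadratically. -/
theorem exists_bestResponse {γ τ K δρ : ℝ} (hγ0 : 0 < γ) (hγ1 : γ < 1) (hτ : 0 < τ)
    {R : S → A → ℝ} (P : S → A → stdSimplex ℝ S) (hR : ∀ s a, |R s a| ≤ K) {ρ : stdSimplex ℝ S}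
    (hρ : ∀ s, δρ ≤ ρ.1 s) {V : Param S A → S → ℝ}
    (hV : ∀ w, IsSoftValue γ τ R P (policy w) (V w)) :
    ∃ w ∈ centered S A, ‖w‖ ≤ logitRadius S A γ τ K ∧
      (∀ u, ∑ s, ρ.1 s * V u s ≤ ∑ s, ρ.1 s * V w s) ∧
      ∀ u ∈ centered S A, ‖u‖ ≤ logitRadius S A γ τ K + 1 →
        (∑ s, ρ.1 s * V u s) + growthModulus S A γ τ K δρ * ‖u - w‖ ^ 2
          ≤ ∑ s, ρ.1 s * V w s := by
  obtain ⟨w, hw, hwn, hopt⟩ := exists_optimal_logits hγ0 hγ1 hτ P hR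
  refine ⟨w, hw, hwn, fun u => ?_, fun u hu hun => ?_⟩
  · refine Finset.sum_le_sum fun s _ => mul_le_mul_of_nonneg_left ?_ (ρ.2.1 s)
    have h1 := hopt _ (hV w) _ _ (hV u) s
    have h2 := mul_nonneg hτ.le (relEntropy_nonneg (policy u s) (policy w s) (softmax_pos _))
    linarith
  · set r := logitRadius S A γ τ K + 1 with hr
    set δ := policyBound A r with hδ
    have hδ0 : 0 < δ := policyBound_pos r
    have hbd : ∀ v : Param S A, ‖v‖ ≤ r → ∀ s a, δ ≤ (policy v s).1 a := fun v hv s a =>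
      softmax_lower_bound (fun a => (PiLp.norm_apply_le v (s, a)).trans hv) a
    have h1 : ∀ s, δ ^ 2 / 4 * ∑ a, (u (s, a) - w (s, a)) ^ 2
        ≤ relEntropy (policy u s) (policy w s) := fun s =>
      sum_sq_logits_le_relEntropy hδ0 (hbd u hun s) (hbd w (hwn.trans (by linarith)) s)
        (hu s) (hw s)
    have h2 : ‖u - w‖ ^ 2 = ∑ s, ∑ a, (u (s, a) - w (s, a)) ^ 2 := by
      rw [EuclideanSpace.norm_sq_eq, Fintype.sum_prod_type]
      simp
    have h3 : ∀ s, ρ.1 s * V u s + δρ * τ * (δ ^ 2 / 4 * ∑ a, (u (s, a) - w (s, a)) ^ 2)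
        ≤ ρ.1 s * V w s := by
      intro s
      have h4 := mul_le_mul_of_nonneg_left (hopt _ (hV w) _ _ (hV u) s) (ρ.2.1 s)
      have h5 : δρ * (τ * (δ ^ 2 / 4 * ∑ a, (u (s, a) - w (s, a)) ^ 2))
          ≤ ρ.1 s * (τ * relEntropy (policy u s) (policy w s)) :=
        mul_le_mul (hρ s) (mul_le_mul_of_nonneg_left (h1 s) hτ.le) (by positivity) (ρ.2.1 s)
      linarith
    calc _ = ∑ s, (ρ.1 s * V u s + δρ * τ * (δ ^ 2 / 4 * ∑ a, (u (s, a) - w (s, a)) ^ 2)) := by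
          rw [Finset.sum_add_distrib, ← Finset.mul_sum, ← Finset.mul_sum, h2, growthModulus]
          ring
      _ ≤ _ := Finset.sum_le_sum fun s _ => h3 s

end BestResponse

/-! ### The decision problems of the two players -/

section Players

variable {d : ℕ} {S A B : Type*} [Fintype S] [Fintype A] [Fintype B]

/-- The mixture of finitely many distributions. -/
def mixture {ι : Type*} [Fintype ι] (p : stdSimplex ℝ ι) (P : ι → stdSimplex ℝ S) :
    stdSimplex ℝ S :=
  ⟨fun s => ∑ i, p.1 i * (P i).1 s,
    fun s => Finset.sum_nonneg fun i _ => mul_nonneg (p.2.1 i) ((P i).2.1 s), by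
    rw [Finset.sum_comm]
    simp only [← Finset.mul_sum, (P _).2.2, mul_one, p.2.2]⟩

/-- The reward of the max-player against the policy `p`. -/
noncomputable def maxReward (τφ : ℝ) (M : Game d S A B) (x : UpperVar d) (p : S → stdSimplex ℝ A)
    (s : S) (b : B) : ℝ :=
  ∑ a, (p s).1 a * M.reward x s a b - τφ * entropy (p s)

/-- The transition kernel of the max-player against the policy `p`. -/
def maxTransition (M : Game d S A B) (p : S → stdSimplex ℝ A) (s : S) (b : B) : stdSimplex ℝ S :=
  mixture (p s) fun a => M.transition s a b

/-- The reward of the min-player, as a maximiser of the negative objective, against the policy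
`q`. -/
noncomputable def minReward (τψ : ℝ) (M : Game d S A B) (x : UpperVar d) (q : S → stdSimplex ℝ B)
    (s : S) (a : A) : ℝ :=
  -(∑ b, (q s).1 b * M.reward x s a b + τψ * entropy (q s))

/-- The transition kernel of the min-player against the policy `q`. -/
def minTransition (M : Game d S A B) (q : S → stdSimplex ℝ B) (s : S) (a : A) : stdSimplex ℝ S :=
  mixture (q s) fun b => M.transition s a b

lemma simplex_sum_const_mul {ι : Type*} [Fintype ι] (p : stdSimplex ℝ ι) (c : ℝ) :
    ∑ i, p.1 i * c = c := by
  rw [← Finset.sum_mul, p.2.2, one_mul]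

lemma mixture_sum {ι : Type*} [Fintype ι] (p : stdSimplex ℝ ι) (P : ι → stdSimplex ℝ S)
    (U : S → ℝ) : ∑ s, (mixture p P).1 s * U s = ∑ i, p.1 i * ∑ s, (P i).1 s * U s := by
  simp only [mixture, Finset.sum_mul, Finset.mul_sum, mul_assoc]
  rw [Finset.sum_comm]

lemma sum_mul_sum_mul_comm {ι κ : Type*} [Fintype ι] [Fintype κ] (p : ι → ℝ) (q : κ → ℝ)
    (F : ι → κ → ℝ) : ∑ i, p i * ∑ j, q j * F i j = ∑ j, q j * ∑ i, p i * F i j := by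
  simp only [Finset.mul_sum]
  rw [Finset.sum_comm]
  simp only [mul_left_comm]

lemma isSoftValue_max {γ : ℝ} (hγ0 : 0 < γ) (hγ1 : γ < 1) (τφ τψ : ℝ) (M : Game d S A B)
    (x : UpperVar d) (p : S → stdSimplex ℝ A) (q : S → stdSimplex ℝ B) :
    IsSoftValue γ τψ (maxReward τφ M x p) (maxTransition M p) q (value γ τφ τψ M x p q) := by
  intro s
  rw [value_bellman hγ0 hγ1 τφ τψ M x p q s]
  rw [sum_mul_sum_mul_comm]
  simp only [qValue, maxReward, maxTransition, mixture_sum, regularizer]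
  simp only [mul_add, mul_sub, Finset.sum_add_distrib, Finset.sum_sub_distrib,
    simplex_sum_const_mul, neg_mul, mul_neg, Finset.sum_neg_distrib]
  simp only [Finset.mul_sum, mul_left_comm γ]
  ring

lemma isSoftValue_min {γ : ℝ} (hγ0 : 0 < γ) (hγ1 : γ < 1) (τφ τψ : ℝ) (M : Game d S A B)
    (x : UpperVar d) (p : S → stdSimplex ℝ A) (q : S → stdSimplex ℝ B) :
    IsSoftValue γ τφ (minReward τψ M x q) (minTransition M q) p
      (fun s => - value γ τφ τψ M x p q s) := by
  intro s
  simp only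
  rw [value_bellman hγ0 hγ1 τφ τψ M x p q s]
  simp only [qValue, minReward, minTransition, mixture_sum, regularizer]
  simp only [mul_add, mul_neg, Finset.sum_add_distrib, Finset.sum_neg_distrib,
    simplex_sum_const_mul, neg_mul]
  simp only [Finset.mul_sum, mul_left_comm γ]
  ring

lemma abs_maxReward_le {S A B : Type*} [Fintype S] [Fintype A] {τφ Br : ℝ} (hτφ : 0 < τφ)
    {M : Game d S A B} {x : UpperVar d} (hr : ∀ s a b, |M.reward x s a b| ≤ Br)
    (p : S → stdSimplex ℝ A) (s : S) (b : B) :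
    |maxReward τφ M x p s b| ≤ Br + τφ * Fintype.card A := by
  refine (abs_sub _ _).trans (add_le_add (simplex_abs_sum_le _ fun a => hr s a b) ?_)
  rw [abs_of_nonneg (mul_nonneg hτφ.le (entropy_nonneg _))]
  exact mul_le_mul_of_nonneg_left (entropy_le_card _) hτφ.le

lemma abs_minReward_le {S A B : Type*} [Fintype S] [Fintype B] {τψ Br : ℝ} (hτψ : 0 < τψ)
    {M : Game d S A B} {x : UpperVar d} (hr : ∀ s a b, |M.reward x s a b| ≤ Br)
    (q : S → stdSimplex ℝ B) (s : S) (a : A) :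
    |minReward τψ M x q s a| ≤ Br + τψ * Fintype.card B := by
  rw [minReward, abs_neg]
  refine (abs_add_le _ _).trans (add_le_add (simplex_abs_sum_le _ fun b => hr s a b) ?_)
  rw [abs_of_nonneg (mul_nonneg hτψ.le (entropy_nonneg _))]
  exact mul_le_mul_of_nonneg_left (entropy_le_card _) hτψ.le

end Players

/-! ### Regularity in terms of Fréchet derivatives -/

section Conversion

variable {d : ℕ} {S A B : Type*} [Fintype S] [Fintype A] [Fintype B]

lemma norm_fst_le {X Y : Type*} [NormedAddCommGroup X] [NormedAddCommGroup Y]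
    (z : WithLp 2 (X × Y)) : ‖z.fst‖ ≤ ‖z‖ := by
  refine le_of_sq_le_sq ?_ (norm_nonneg _)
  rw [WithLp.prod_norm_sq_eq_of_L2]
  linarith [sq_nonneg ‖z.snd‖]

lemma norm_snd_le {X Y : Type*} [NormedAddCommGroup X] [NormedAddCommGroup Y]
    (z : WithLp 2 (X × Y)) : ‖z.snd‖ ≤ ‖z‖ := by
  refine le_of_sq_le_sq ?_ (norm_nonneg _)
  rw [WithLp.prod_norm_sq_eq_of_L2]
  linarith [sq_nonneg ‖z.fst‖]

lemma norm_le_fst_add_snd {X Y : Type*} [NormedAddCommGroup X] [NormedAddCommGroup Y]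
    (z : WithLp 2 (X × Y)) : ‖z‖ ≤ ‖z.fst‖ + ‖z.snd‖ := by
  refine le_of_sq_le_sq ?_ (by positivity)
  rw [WithLp.prod_norm_sq_eq_of_L2]
  nlinarith [norm_nonneg z.fst, norm_nonneg z.snd]

lemma norm_sub_le_sumDist (z w : FullVar d S A B) : ‖z - w‖ ≤ sumDist z w := by
  have h1 := norm_le_fst_add_snd (z - w)
  have h2 := norm_le_fst_add_snd (z - w).snd
  rw [sumDist, add_assoc]
  exact h1.trans (add_le_add le_rfl h2)

lemma sumDist_le (z w : FullVar d S A B) : sumDist z w ≤ 3 * ‖z - w‖ := by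
  have h1 := norm_fst_le (z - w)
  have h2 := norm_snd_le (z - w)
  have h3 := (norm_fst_le (z - w).snd).trans h2
  have h4 := (norm_snd_le (z - w).snd).trans h2
  have e1 : (z - w).fst = z.fst - w.fst := rfl
  have e2 : (z - w).snd.fst = z.snd.fst - w.snd.fst := rfl
  have e3 : (z - w).snd.snd = z.snd.snd - w.snd.snd := rfl
  rw [e1] at h1
  rw [e2] at h3
  rw [e3] at h4
  rw [sumDist]
  linarith

lemma sumDist_nonneg (z w : FullVar d S A B) : 0 ≤ sumDist z w := by
  unfold sumDist; positivity

/-- The Riesz isomorphism of a real Hilbert space, as a linear isometry. -/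
noncomputable def riesz (E : Type*) [NormedAddCommGroup E] [InnerProductSpace ℝ E]
    [CompleteSpace E] : E ≃ₗᵢ[ℝ] (E →L[ℝ] ℝ) :=
  InnerProductSpace.toDual ℝ E

section Riesz

variable {E : Type*} [NormedAddCommGroup E] [InnerProductSpace ℝ E] [CompleteSpace E] {f : E → ℝ}

lemma fderiv_eq_riesz_gradient : fderiv ℝ f = fun p => riesz E (gradient f p) :=
  funext fun p => ((riesz E).apply_symm_apply (fderiv ℝ f p)).symm

lemma gradient_eq_riesz_fderiv : gradient f = fun p => (riesz E).symm (fderiv ℝ f p) := rfl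

lemma inner_gradient_eq {f' : E →L[ℝ] ℝ} {p : E} (hf : HasFDerivAt f f' p) (v : E) :
    inner ℝ (gradient f p) v = f' v := by
  rw [gradient, InnerProductSpace.toDual_symm_apply, hf.fderiv]

lemma norm_gradient (p : E) : ‖gradient f p‖ = ‖fderiv ℝ f p‖ :=
  (riesz E).symm.norm_map _

lemma norm_gradient_sub (p q : E) :
    ‖gradient f p - gradient f q‖ = ‖fderiv ℝ f p - fderiv ℝ f q‖ := by
  simp only [gradient_eq_riesz_fderiv, ← map_sub, LinearIsometryEquiv.norm_map]

lemma differentiable_fderiv_iff_gradient :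
    Differentiable ℝ (fderiv ℝ f) ↔ Differentiable ℝ (gradient f) := by
  rw [fderiv_eq_riesz_gradient]
  exact (riesz E).comp_differentiable_iff

lemma norm_fderiv_fderiv_sub (p q : E) :
    ‖fderiv ℝ (fderiv ℝ f) p - fderiv ℝ (fderiv ℝ f) q‖
      = ‖fderiv ℝ (gradient f) p - fderiv ℝ (gradient f) q‖ := by
  have h : ∀ p, fderiv ℝ (fderiv ℝ f) p
      = ((riesz E).toContinuousLinearEquiv : E →L[ℝ] (E →L[ℝ] ℝ)).comp
        (fderiv ℝ (gradient f) p) := by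
    intro p
    rw [fderiv_eq_riesz_gradient]
    exact (riesz E).comp_fderiv
  rw [h, h, ← ContinuousLinearMap.comp_sub]
  exact (riesz E).toLinearIsometry.norm_toContinuousLinearMap_comp

end Riesz

lemma lipschitzDerivs_of_assumption {F : UpperVar d → Param S A → Param S B → ℝ} {C L₁ L₂ : ℝ}
    (h : FunctionAssumption F C L₁ L₂) : LipschitzDerivs (3 * |L₁|) (3 * |L₂|) (joint F) := by
  have key : ∀ (L : ℝ) (z w : FullVar d S A B), L * sumDist z w ≤ 3 * |L| * ‖z - w‖ := by
    intro L z w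
    calc L * sumDist z w ≤ |L| * sumDist z w :=
          mul_le_mul_of_nonneg_right (le_abs_self _) (sumDist_nonneg z w)
      _ ≤ |L| * (3 * ‖z - w‖) := mul_le_mul_of_nonneg_left (sumDist_le z w) (abs_nonneg _)
      _ = _ := by ring
  refine ⟨h.smooth.1, differentiable_fderiv_iff_gradient.2 h.hessian.2.1, fun p q => ?_,
    fun p q => ?_⟩
  · rw [← norm_gradient_sub]
    exact (h.smooth.2 p q).trans (key _ _ _)
  · rw [norm_fderiv_fderiv_sub]
    exact (h.hessian.2.2 p q).trans (key _ _ _)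

lemma LipschitzDerivs.smoothIn {F : UpperVar d → Param S A → Param S B → ℝ} {L₁ L₂ K : ℝ}
    (h : LipschitzDerivs L₁ L₂ (joint F)) (hK : 0 ≤ K) (hL : L₁ ≤ K) : SmoothIn K F := by
  refine ⟨h.differentiable, fun z w => ?_⟩
  rw [norm_gradient_sub]
  calc _ ≤ L₁ * ‖z - w‖ := h.lip_fderiv z w
    _ ≤ K * sumDist z w := mul_le_mul hL (norm_sub_le_sumDist z w) (norm_nonneg _) hK

lemma LipschitzDerivs.hessianLipschitzIn {F : UpperVar d → Param S A → Param S B → ℝ}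
    {L₁ L₂ K : ℝ} (h : LipschitzDerivs L₁ L₂ (joint F)) (hK : 0 ≤ K) (hL : L₂ ≤ K) :
    HessianLipschitzIn K F := by
  refine ⟨h.differentiable, differentiable_fderiv_iff_gradient.1 h.differentiable_fderiv,
    fun z w => ?_⟩
  rw [← norm_fderiv_fderiv_sub]
  calc _ ≤ L₂ * ‖z - w‖ := h.lip_fderiv_fderiv z w
    _ ≤ K * sumDist z w := mul_le_mul hL (norm_sub_le_sumDist z w) (norm_nonneg _) hK

end Conversion

/-! ### Coordinates of the space of all variables -/

section Inclusions

variable {d : ℕ} {S A B : Type*} [Fintype S] [Fintype A] [Fintype B]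

/-- The vector `(x, φ, ψ)`. -/
def fullVec (x : UpperVar d) (φ : Param S A) (ψ : Param S B) : FullVar d S A B :=
  WithLp.toLp 2 (x, WithLp.toLp 2 (φ, ψ))

lemma norm_fullVec_sq (x : UpperVar d) (φ : Param S A) (ψ : Param S B) :
    ‖fullVec x φ ψ‖ ^ 2 = ‖x‖ ^ 2 + (‖φ‖ ^ 2 + ‖ψ‖ ^ 2) := by
  rw [WithLp.prod_norm_sq_eq_of_L2, fullVec, WithLp.prod_norm_sq_eq_of_L2]
  rfl

lemma norm_fullVar_sq (z : FullVar d S A B) :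
    ‖z‖ ^ 2 = ‖z.fst‖ ^ 2 + (‖z.snd.fst‖ ^ 2 + ‖z.snd.snd‖ ^ 2) := norm_fullVec_sq _ _ _

lemma joint_fullVec {d : ℕ} {S A B : Type*}
    (F : UpperVar d → Param S A → Param S B → ℝ) (x : UpperVar d) (φ : Param S A)
    (ψ : Param S B) : joint F (fullVec x φ ψ) = F x φ ψ := rfl

lemma sumDist_fullVec (x x' : UpperVar d) (φ φ' : Param S A) (ψ ψ' : Param S B) :
    sumDist (fullVec x φ ψ) (fullVec x' φ' ψ') = ‖x - x'‖ + ‖φ - φ'‖ + ‖ψ - ψ'‖ := rfl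

/-- The continuous linear map `e ↦ (f e, g e)` into the Euclidean product. -/
noncomputable def pairL {E X Y : Type*} [NormedAddCommGroup E] [NormedSpace ℝ E]
    [NormedAddCommGroup X] [NormedSpace ℝ X] [NormedAddCommGroup Y] [NormedSpace ℝ Y]
    (f : E →L[ℝ] X) (g : E →L[ℝ] Y) : E →L[ℝ] WithLp 2 (X × Y) :=
  ((WithLp.prodContinuousLinearEquiv 2 ℝ X Y).symm : X × Y →L[ℝ] WithLp 2 (X × Y)).comp
    (f.prod g)

/-- `(x, φ, ψ) ↦ (x, φ, 0)`. -/
noncomputable def dropMax (d : ℕ) (S A B : Type*) [Fintype S] [Fintype A] [Fintype B] :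
    FullVar d S A B →L[ℝ] FullVar d S A B :=
  pairL (WithLp.fstL 2 ℝ _ _) (pairL ((WithLp.fstL 2 ℝ _ _).comp (WithLp.sndL 2 ℝ _ _)) 0)

/-- `(x, φ, ψ) ↦ (x, 0, ψ)`. -/
noncomputable def dropMin (d : ℕ) (S A B : Type*) [Fintype S] [Fintype A] [Fintype B] :
    FullVar d S A B →L[ℝ] FullVar d S A B :=
  pairL (WithLp.fstL 2 ℝ _ _) (pairL 0 ((WithLp.sndL 2 ℝ _ _).comp (WithLp.sndL 2 ℝ _ _)))

/-- `φ ↦ (0, φ, 0)`. -/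
noncomputable def inclMin (d : ℕ) (S A B : Type*) [Fintype S] [Fintype A] [Fintype B] :
    Param S A →L[ℝ] FullVar d S A B :=
  pairL 0 (pairL (ContinuousLinearMap.id ℝ _) 0)

/-- `ψ ↦ (0, 0, ψ)`. -/
noncomputable def inclMax (d : ℕ) (S A B : Type*) [Fintype S] [Fintype A] [Fintype B] :
    Param S B →L[ℝ] FullVar d S A B :=
  pairL 0 (pairL 0 (ContinuousLinearMap.id ℝ _))

/-- `θ ↦ (0, θ)`. -/
noncomputable def inclTheta (d : ℕ) (S A B : Type*) [Fintype S] [Fintype A] [Fintype B] :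
    JointParam S A B →L[ℝ] FullVar d S A B :=
  pairL 0 (ContinuousLinearMap.id ℝ _)

lemma dropMax_apply (z : FullVar d S A B) : dropMax d S A B z = fullVec z.fst z.snd.fst 0 := rfl
lemma dropMin_apply (z : FullVar d S A B) : dropMin d S A B z = fullVec z.fst 0 z.snd.snd := rfl
lemma inclMin_apply (φ : Param S A) : inclMin d S A B φ = fullVec 0 φ 0 := rfl
lemma inclMax_apply (ψ : Param S B) : inclMax d S A B ψ = fullVec 0 0 ψ := rfl
lemma inclTheta_apply (θ : JointParam S A B) :
    inclTheta d S A B θ = fullVec 0 θ.fst θ.snd := rfl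

lemma fullVec_add {d : ℕ} {S A B : Type*} (x x' : UpperVar d) (φ φ' : Param S A)
    (ψ ψ' : Param S B) :
    fullVec x φ ψ + fullVec x' φ' ψ' = fullVec (x + x') (φ + φ') (ψ + ψ') := rfl

lemma dropMax_add_inclMax (z : FullVar d S A B) (ψ : Param S B) :
    dropMax d S A B z + inclMax d S A B ψ = fullVec z.fst z.snd.fst ψ := by
  rw [dropMax_apply, inclMax_apply, fullVec_add, add_zero, add_zero, zero_add]

lemma dropMin_add_inclMin (z : FullVar d S A B) (φ : Param S A) :
    dropMin d S A B z + inclMin d S A B φ = fullVec z.fst φ z.snd.snd := by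
  rw [dropMin_apply, inclMin_apply, fullVec_add, add_zero, zero_add, add_zero]

lemma norm_dropMax_le (z : FullVar d S A B) : ‖dropMax d S A B z‖ ≤ ‖z‖ := by
  refine le_of_sq_le_sq ?_ (norm_nonneg _)
  rw [dropMax_apply, norm_fullVec_sq, norm_fullVar_sq, norm_zero]
  gcongr
  simp

lemma norm_dropMin_le (z : FullVar d S A B) : ‖dropMin d S A B z‖ ≤ ‖z‖ := by
  refine le_of_sq_le_sq ?_ (norm_nonneg _)
  rw [dropMin_apply, norm_fullVec_sq, norm_fullVar_sq, norm_zero]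
  gcongr
  simp

lemma norm_inclMin_le (φ : Param S A) : ‖inclMin d S A B φ‖ ≤ ‖φ‖ := by
  refine le_of_sq_le_sq ?_ (norm_nonneg _)
  rw [inclMin_apply, norm_fullVec_sq]
  simp

lemma norm_inclMax_le (ψ : Param S B) : ‖inclMax d S A B ψ‖ ≤ ‖ψ‖ := by
  refine le_of_sq_le_sq ?_ (norm_nonneg _)
  rw [inclMax_apply, norm_fullVec_sq]
  simp

variable {F : UpperVar d → Param S A → Param S B → ℝ}

lemma hasFDerivAt_min (hF : Differentiable ℝ (joint F)) (x : UpperVar d) (φ : Param S A)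
    (ψ : Param S B) : HasFDerivAt (fun φ => F x φ ψ)
      ((fderiv ℝ (joint F) (fullVec x φ ψ)).comp (inclMin d S A B)) φ := by
  have h1 : HasFDerivAt (fun φ => fullVec x 0 ψ + inclMin d S A B φ) (inclMin d S A B) φ :=
    (inclMin d S A B).hasFDerivAt.const_add _
  have e : ∀ φ, fullVec x 0 ψ + inclMin d S A B φ = fullVec x φ ψ := fun φ => by
    rw [inclMin_apply, fullVec_add, add_zero, zero_add, add_zero]
  simp only [e] at h1
  exact (hF (fullVec x φ ψ)).hasFDerivAt.comp φ h1

lemma hasFDerivAt_maxVar (hF : Differentiable ℝ (joint F)) (x : UpperVar d) (φ : Param S A)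
    (ψ : Param S B) : HasFDerivAt (fun ψ => F x φ ψ)
      ((fderiv ℝ (joint F) (fullVec x φ ψ)).comp (inclMax d S A B)) ψ := by
  have h1 : HasFDerivAt (fun ψ => fullVec x φ 0 + inclMax d S A B ψ) (inclMax d S A B) ψ :=
    (inclMax d S A B).hasFDerivAt.const_add _
  have e : ∀ ψ, fullVec x φ 0 + inclMax d S A B ψ = fullVec x φ ψ := fun ψ => by
    rw [inclMax_apply, fullVec_add, add_zero, add_zero, zero_add]
  simp only [e] at h1
  exact (hF (fullVec x φ ψ)).hasFDerivAt.comp ψ h1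

lemma hasFDerivAt_inTheta (hF : Differentiable ℝ (joint F)) (x : UpperVar d)
    (θ : JointParam S A B) : HasFDerivAt (inTheta F x)
      ((fderiv ℝ (joint F) (fullVec x θ.fst θ.snd)).comp (inclTheta d S A B)) θ := by
  have h1 : HasFDerivAt (fun θ => fullVec x 0 0 + inclTheta d S A B θ) (inclTheta d S A B) θ :=
    (inclTheta d S A B).hasFDerivAt.const_add _
  have e : ∀ θ, fullVec x 0 0 + inclTheta d S A B θ = fullVec x θ.fst θ.snd := fun θ => by
    rw [inclTheta_apply, fullVec_add, add_zero, zero_add, zero_add]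
  simp only [e] at h1
  exact (hF (fullVec x θ.fst θ.snd)).hasFDerivAt.comp θ h1

end Inclusions

/-! ### The two single-player problems of the game -/

section Game

variable {d : ℕ} {S A B : Type*} [Fintype S] [Fintype A] [Fintype B] [Nonempty A] [Nonempty B]
  {γ τφ τψ : ℝ} {M : Game d S A B} {Br Cr Lr δπ δρ CJ LJ₁ LJ₂ : ℝ} {Φ : Set (Param S A)}
  {Ψ : Set (Param S B)}

/-- The radius of a ball containing the centred best responses of the max-player. -/
noncomputable def maxRadius (S A B : Type*) [Fintype S] [Fintype A] [Fintype B]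
    (γ τφ τψ Br : ℝ) : ℝ :=
  logitRadius S B γ τψ (Br + τφ * Fintype.card A)

/-- The radius of a ball containing the centred best responses of the min-player. -/
noncomputable def minRadius (S A B : Type*) [Fintype S] [Fintype A] [Fintype B]
    (γ τφ τψ Br : ℝ) : ℝ :=
  logitRadius S A γ τφ (Br + τψ * Fintype.card B)

/-- The modulus of quadratic growth at the best response of the max-player. -/
noncomputable def maxModulus (S A B : Type*) [Fintype S] [Fintype A] [Fintype B]
    (γ τφ τψ Br δρ : ℝ) : ℝ :=
  growthModulus S B γ τψ (Br + τφ * Fintype.card A) δρ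

/-- The modulus of quadratic growth at the best response of the min-player. -/
noncomputable def minModulus (S A B : Type*) [Fintype S] [Fintype A] [Fintype B]
    (γ τφ τψ Br δρ : ℝ) : ℝ :=
  growthModulus S A γ τφ (Br + τψ * Fintype.card B) δρ

lemma neg_objective_eq (x : UpperVar d) (φ : Param S A) (ψ : Param S B) :
    - objective γ τφ τψ M x φ ψ
      = ∑ s, M.initial.1 s * (- value γ τφ τψ M x (policy φ) (policy ψ) s) := by
  simp [objective]

lemma exists_max_response (hγ0 : 0 < γ) (hγ1 : γ < 1) (hτφ : 0 < τφ) (hτψ : 0 < τψ)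
    (hM : GameAssumption M Br Cr Lr δπ δρ Φ Ψ) (x : UpperVar d) (φ : Param S A) :
    ∃ w : centered S B, ‖w‖ ≤ maxRadius S A B γ τφ τψ Br ∧
      (∀ ψ, objective γ τφ τψ M x φ ψ ≤ objective γ τφ τψ M x φ w) ∧
      ∀ u : centered S B, ‖u‖ ≤ maxRadius S A B γ τφ τψ Br + 1 →
        objective γ τφ τψ M x φ u + maxModulus S A B γ τφ τψ Br δρ * ‖u - w‖ ^ 2
          ≤ objective γ τφ τψ M x φ w := by
  obtain ⟨w, hw, h1, h2, h3⟩ := exists_bestResponse hγ0 hγ1 hτψ (maxTransition M (policy φ))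
    (abs_maxReward_le hτφ (hM.reward_bounded x) (policy φ)) hM.initial
    (fun ψ => isSoftValue_max hγ0 hγ1 τφ τψ M x (policy φ) (policy ψ))
  exact ⟨⟨w, hw⟩, h1, h2, fun u hu => h3 u u.2 hu⟩

lemma exists_min_response (hγ0 : 0 < γ) (hγ1 : γ < 1) (hτφ : 0 < τφ) (hτψ : 0 < τψ)
    (hM : GameAssumption M Br Cr Lr δπ δρ Φ Ψ) (x : UpperVar d) (ψ : Param S B) :
    ∃ w : centered S A, ‖w‖ ≤ minRadius S A B γ τφ τψ Br ∧
      (∀ φ, objective γ τφ τψ M x w ψ ≤ objective γ τφ τψ M x φ ψ) ∧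
      ∀ u : centered S A, ‖u‖ ≤ minRadius S A B γ τφ τψ Br + 1 →
        - objective γ τφ τψ M x u ψ + minModulus S A B γ τφ τψ Br δρ * ‖u - w‖ ^ 2
          ≤ - objective γ τφ τψ M x w ψ := by
  obtain ⟨w, hw, h1, h2, h3⟩ := exists_bestResponse hγ0 hγ1 hτφ (minTransition M (policy ψ))
    (abs_minReward_le hτψ (hM.reward_bounded x) (policy ψ)) hM.initial
    (fun φ => isSoftValue_min hγ0 hγ1 τφ τψ M x (policy φ) (policy ψ))
  simp only [← neg_objective_eq] at h2 h3
  exact ⟨⟨w, hw⟩, h1, fun φ => neg_le_neg_iff.1 (h2 φ), fun u hu => h3 u u.2 hu⟩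

/-- The Polyak–Łojasiewicz inequality of the min-player, for a fixed opponent. -/
lemma objective_PL_min (hγ0 : 0 < γ) (hγ1 : γ < 1) (hτφ : 0 < τφ) (hδπ : 0 < δπ) (hδρ : 0 < δρ)
    (hM : GameAssumption M Br Cr Lr δπ δρ Φ Ψ)
    (hJ : Differentiable ℝ (joint (objective γ τφ τψ M))) (x : UpperVar d) {φ : Param S A}
    (hφ : φ ∈ Φ) (φ' : Param S A) (ψ : Param S B) :
    δρ ^ 2 * δπ ^ 2 * (1 - γ) * τφ *
        (objective γ τφ τψ M x φ ψ - objective γ τφ τψ M x φ' ψ)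
      ≤ ‖gradient (fun φ => objective γ τφ τψ M x φ ψ) φ‖ ^ 2 := by
  have hd : DifferentiableAt ℝ (fun φ => - objective γ τφ τψ M x φ ψ) φ :=
    (hasFDerivAt_min hJ x φ ψ).differentiableAt.neg
  simp only [neg_objective_eq] at hd
  have h := discounted_reward_PL hγ0 hγ1 hτφ hδρ hδπ hM.initial
    (fun φ => isSoftValue_min hγ0 hγ1 τφ τψ M x (policy φ) (policy ψ)) (hM.policy_min φ hφ) hd φ'
  simp only [← neg_objective_eq] at h
  rw [norm_gradient, fderiv_fun_neg, norm_neg, ← norm_gradient, neg_sub_neg] at h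
  exact h

/-- The Polyak–Łojasiewicz inequality of the max-player, for a fixed opponent. -/
lemma objective_PL_max (hγ0 : 0 < γ) (hγ1 : γ < 1) (hτψ : 0 < τψ) (hδπ : 0 < δπ) (hδρ : 0 < δρ)
    (hM : GameAssumption M Br Cr Lr δπ δρ Φ Ψ)
    (hJ : Differentiable ℝ (joint (objective γ τφ τψ M))) (x : UpperVar d) (φ : Param S A)
    {ψ : Param S B} (hψ : ψ ∈ Ψ) (ψ' : Param S B) :
    δρ ^ 2 * δπ ^ 2 * (1 - γ) * τψ *
        (objective γ τφ τψ M x φ ψ' - objective γ τφ τψ M x φ ψ)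
      ≤ ‖gradient (fun ψ => objective γ τφ τψ M x φ ψ) ψ‖ ^ 2 :=
  discounted_reward_PL hγ0 hγ1 hτψ hδρ hδπ hM.initial
    (fun ψ => isSoftValue_max hγ0 hγ1 τφ τψ M x (policy φ) (policy ψ)) (hM.policy_max ψ hψ)
    (hasFDerivAt_maxVar hJ x φ ψ).differentiableAt ψ'

end Game

/-! ### Best responses and the gradient of the Nikaido–Isoda function -/

section NikaidoIsoda

variable {d : ℕ} {S A B : Type*} [Fintype S] [Fintype A] [Fintype B] [Nonempty A] [Nonempty B]
  {γ τφ τψ : ℝ} {M : Game d S A B} {CJ L₁ L₂ cφ cψ rφ rψ : ℝ}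

/-- Centred best responses `yφ(x, ψ)` and `yψ(x, φ)` of both players, at which the objective grows
quadratically. -/
structure BestResponses (γ τφ τψ : ℝ) (M : Game d S A B) (cφ cψ rφ rψ : ℝ)
    (yφ : UpperVar d → Param S B → centered S A) (yψ : UpperVar d → Param S A → centered S B) :
    Prop where
  min_le : ∀ x ψ φ, objective γ τφ τψ M x (yφ x ψ) ψ ≤ objective γ τφ τψ M x φ ψ
  le_max : ∀ x φ ψ, objective γ τφ τψ M x φ ψ ≤ objective γ τφ τψ M x φ (yψ x φ)
  argmin : IsQuadraticArgmax (fun p => - joint (objective γ τφ τψ M) p) (dropMin d S A B)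
    ((inclMin d S A B).comp (centered S A).subtypeL) cφ rφ (fun z => yφ z.fst z.snd.snd)
  argmax : IsQuadraticArgmax (joint (objective γ τφ τψ M)) (dropMax d S A B)
    ((inclMax d S A B).comp (centered S B).subtypeL) cψ rψ (fun z => yψ z.fst z.snd.fst)

lemma exists_bestResponses {Br Cr Lr δπ δρ : ℝ} {Φ : Set (Param S A)} {Ψ : Set (Param S B)}
    (hγ0 : 0 < γ) (hγ1 : γ < 1) (hτφ : 0 < τφ) (hτψ : 0 < τψ)
    (hδρ : 0 < δρ) (hM : GameAssumption M Br Cr Lr δπ δρ Φ Ψ) :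
    ∃ yφ yψ, BestResponses γ τφ τψ M (minModulus S A B γ τφ τψ Br δρ)
      (maxModulus S A B γ τφ τψ Br δρ) (minRadius S A B γ τφ τψ Br)
      (maxRadius S A B γ τφ τψ Br) yφ yψ := by
  choose yφ h1 h2 h3 using exists_min_response hγ0 hγ1 hτφ hτψ hM
  choose yψ k1 k2 k3 using exists_max_response hγ0 hγ1 hτφ hτψ hM
  refine ⟨yφ, yψ, h2, k2, ⟨growthModulus_pos hτφ hδρ, norm_dropMin_le,
    fun w => norm_inclMin_le _, fun z => h1 _ _, fun z w hw => ?_⟩,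
    ⟨growthModulus_pos hτψ hδρ, norm_dropMax_le,
    fun w => norm_inclMax_le _, fun z => k1 _ _, fun z w hw => ?_⟩⟩
  · simp only [ContinuousLinearMap.comp_apply, dropMin_add_inclMin]
    exact h3 _ _ w hw
  · simp only [ContinuousLinearMap.comp_apply, dropMax_add_inclMax]
    exact k3 _ _ w hw

namespace BestResponses

variable {yφ : UpperVar d → Param S B → centered S A} {yψ : UpperVar d → Param S A → centered S B}

lemma bestResponsesExist (h : BestResponses γ τφ τψ M cφ cψ rφ rψ yφ yψ) :
    BestResponsesExist γ τφ τψ M :=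
  ⟨fun x φ => ⟨yψ x φ, h.le_max x φ⟩, fun x ψ => ⟨yφ x ψ, h.min_le x ψ⟩⟩

lemma niFunction_eq (h : BestResponses γ τφ τψ M cφ cψ rφ rψ yφ yψ) (x : UpperVar d)
    (φ : Param S A) (ψ : Param S B) :
    niFunction γ τφ τψ M x φ ψ
      = objective γ τφ τψ M x φ (yψ x φ) - objective γ τφ τψ M x (yφ x ψ) ψ := by
  have h1 : IsGreatest (Set.range fun ψ' => objective γ τφ τψ M x φ ψ')
      (objective γ τφ τψ M x φ (yψ x φ)) :=
    ⟨⟨_, rfl⟩, by rintro _ ⟨ψ', rfl⟩; exact h.le_max x φ ψ'⟩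
  have h2 : IsLeast (Set.range fun φ' => objective γ τφ τψ M x φ' ψ)
      (objective γ τφ τψ M x (yφ x ψ) ψ) :=
    ⟨⟨_, rfl⟩, by rintro _ ⟨φ', rfl⟩; exact h.min_le x ψ φ'⟩
  rw [niFunction, iSup, iInf, h1.csSup_eq, h2.csInf_eq]

lemma niFunction_nonneg (h : BestResponses γ τφ τψ M cφ cψ rφ rψ yφ yψ) (x : UpperVar d)
    (φ : Param S A) (ψ : Param S B) : 0 ≤ niFunction γ τφ τψ M x φ ψ := by
  rw [h.niFunction_eq]
  linarith [h.le_max x φ ψ, h.min_le x ψ φ]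

lemma joint_niFunction_eq (h : BestResponses γ τφ τψ M cφ cψ rφ rψ yφ yψ) :
    joint (niFunction γ τφ τψ M)
      = fun z => joint (objective γ τφ τψ M) (dropMax d S A B z +
          ((inclMax d S A B).comp (centered S B).subtypeL) (yψ z.fst z.snd.fst))
        + (- joint (objective γ τφ τψ M) (dropMin d S A B z +
          ((inclMin d S A B).comp (centered S A).subtypeL) (yφ z.fst z.snd.snd))) := by
  funext z
  simp only [ContinuousLinearMap.comp_apply, dropMax_add_inclMax, dropMin_add_inclMin,
    ← sub_eq_add_neg]
  exact h.niFunction_eq _ _ _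

lemma lipschitzDerivs_niFunction (h : BestResponses γ τφ τψ M cφ cψ rφ rψ yφ yψ) (hL₁ : 0 ≤ L₁)
    (hL₂ : 0 ≤ L₂) (hJ : LipschitzDerivs L₁ L₂ (joint (objective γ τφ τψ M))) :
    LipschitzDerivs (L₁ * (1 + L₁ / (2 * cψ)) + L₁ * (1 + L₁ / (2 * cφ)))
      (L₂ * (1 + L₁ / (2 * cψ)) ^ 3 + L₂ * (1 + L₁ / (2 * cφ)) ^ 3)
      (joint (niFunction γ τφ τψ M)) := by
  rw [h.joint_niFunction_eq]
  exact (h.argmax.lipschitzDerivs_max hL₁ hL₂ hJ).add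
    (h.argmin.lipschitzDerivs_max hL₁ hL₂ hJ.neg)

lemma lipschitzIn_niFunction (h : BestResponses γ τφ τψ M cφ cψ rφ rψ yφ yψ)
    (hJ : LipschitzIn CJ (objective γ τφ τψ M)) :
    LipschitzIn (2 * |CJ|) (niFunction γ τφ τψ M) := by
  have hd : ∀ (z w : FullVar d S A B) (p q : FullVar d S A B), sumDist p q ≤ sumDist z w →
      joint (objective γ τφ τψ M) p - joint (objective γ τφ τψ M) q ≤ |CJ| * sumDist z w := by
    intro z w p q hpq
    calc _ ≤ CJ * sumDist p q := (le_abs_self _).trans (hJ p q)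
      _ ≤ |CJ| * sumDist p q := mul_le_mul_of_nonneg_right (le_abs_self _) (sumDist_nonneg p q)
      _ ≤ |CJ| * sumDist z w := mul_le_mul_of_nonneg_left hpq (abs_nonneg _)
  have key : ∀ z w : FullVar d S A B, joint (niFunction γ τφ τψ M) z
      - joint (niFunction γ τφ τψ M) w ≤ 2 * |CJ| * sumDist z w := by
    intro z w
    have e : ∀ z : FullVar d S A B, joint (niFunction γ τφ τψ M) z
        = objective γ τφ τψ M z.fst z.snd.fst (yψ z.fst z.snd.fst)
          - objective γ τφ τψ M z.fst (yφ z.fst z.snd.snd) z.snd.snd :=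
      fun z => h.niFunction_eq _ _ _
    have h1 := hd z w (fullVec z.fst z.snd.fst (yψ z.fst z.snd.fst))
      (fullVec w.fst w.snd.fst (yψ z.fst z.snd.fst)) (by
        rw [sumDist_fullVec, sub_self, norm_zero, sumDist]
        linarith [norm_nonneg (z.snd.snd - w.snd.snd)])
    have h2 := hd z w (fullVec w.fst (yφ z.fst z.snd.snd) w.snd.snd)
      (fullVec z.fst (yφ z.fst z.snd.snd) z.snd.snd) (by
        rw [sumDist_fullVec, sub_self, norm_zero, sumDist, norm_sub_rev w.fst,
          norm_sub_rev w.snd.snd]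
        linarith [norm_nonneg (z.snd.fst - w.snd.fst)])
    have h3 := h.le_max w.fst w.snd.fst (yψ z.fst z.snd.fst)
    have h4 := h.min_le w.fst w.snd.snd (yφ z.fst z.snd.snd)
    rw [e, e]
    simp only [joint_fullVec] at h1 h2
    linarith
  intro z w
  rw [abs_le]
  refine ⟨?_, key z w⟩
  have h1 := key w z
  have h2 : sumDist w z = sumDist z w := by simp only [sumDist, norm_sub_rev]
  rw [h2] at h1
  linarith

/-- The gradient of the Nikaido–Isoda function consists of the gradients of the two players, each
against the best response to it. -/
lemma norm_gradient_niFunction_sq (h : BestResponses γ τφ τψ M cφ cψ rφ rψ yφ yψ) (hL₁ : 0 ≤ L₁)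
    (hL₂ : 0 ≤ L₂) (hJ : LipschitzDerivs L₁ L₂ (joint (objective γ τφ τψ M))) (x : UpperVar d)
    (θ : JointParam S A B) :
    ‖gradient (inTheta (niFunction γ τφ τψ M) x) θ‖ ^ 2
      = ‖gradient (fun φ => objective γ τφ τψ M x φ (yψ x θ.fst)) θ.fst‖ ^ 2
        + ‖gradient (fun ψ => objective γ τφ τψ M x (yφ x θ.snd) ψ) θ.snd‖ ^ 2 := by
  set J := joint (objective γ τφ τψ M) with hJdef
  set z := fullVec x θ.fst θ.snd with hz
  have hg := hasFDerivAt_inTheta (h.lipschitzDerivs_niFunction hL₁ hL₂ hJ).differentiable x θ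
  have e1 : dropMax d S A B z + inclMax d S A B (yψ x θ.fst) = fullVec x θ.fst (yψ x θ.fst) :=
    dropMax_add_inclMax z _
  have e2 : dropMin d S A B z + inclMin d S A B (yφ x θ.snd) = fullVec x (yφ x θ.snd) θ.snd :=
    dropMin_add_inclMin z _
  set G := gradient (inTheta (niFunction γ τφ τψ M) x) θ with hG
  have hGi : ∀ v, inner ℝ G v = fderiv ℝ J (fullVec x θ.fst (yψ x θ.fst)) (fullVec 0 v.fst 0)
      - fderiv ℝ J (fullVec x (yφ x θ.snd) θ.snd) (fullVec 0 0 v.snd) := by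
    intro v
    refine (inner_gradient_eq hg v).trans ?_
    rw [← e1, ← e2, h.joint_niFunction_eq]
    exact h.argmax.fderiv_max_sub_min h.argmin hL₁ hJ z _
  have h4 : fullVec (0 : UpperVar d) (0 : Param S A) (0 : Param S B) = 0 := rfl
  have hfst : gradient (fun φ => objective γ τφ τψ M x φ (yψ x θ.fst)) θ.fst = G.fst := by
    refine ext_inner_right ℝ fun v => ?_
    have h3 := hGi (WithLp.toLp 2 (v, 0))
    rw [WithLp.prod_inner_apply] at h3
    change inner ℝ G.fst v + inner ℝ G.snd 0 = fderiv ℝ J _ (fullVec 0 v 0)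
      - fderiv ℝ J _ (fullVec 0 0 0) at h3
    simp only [inner_zero_right, add_zero, h4, map_zero, sub_zero] at h3
    exact (inner_gradient_eq (hasFDerivAt_min hJ.differentiable x _ _) v).trans h3.symm
  have hsnd : gradient (fun ψ => objective γ τφ τψ M x (yφ x θ.snd) ψ) θ.snd = - G.snd := by
    refine ext_inner_right ℝ fun v => ?_
    have h3 := hGi (WithLp.toLp 2 (0, v))
    rw [WithLp.prod_inner_apply] at h3
    change inner ℝ G.fst 0 + inner ℝ G.snd v = fderiv ℝ J _ (fullVec 0 0 0)
      - fderiv ℝ J _ (fullVec 0 0 v) at h3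
    simp only [inner_zero_right, zero_add, h4, map_zero, zero_sub] at h3
    rw [inner_neg_left]
    exact (inner_gradient_eq (hasFDerivAt_maxVar hJ.differentiable x _ _) v).trans
      (neg_eq_iff_eq_neg.2 h3).symm
  rw [hfst, hsnd, norm_neg, WithLp.prod_norm_sq_eq_of_L2]

/-- The Polyak–Łojasiewicz inequality of the Nikaido–Isoda function. The inequalities of the two
players are combined by weak duality: `J(x, φ', yψ) ≤ max_ψ J(x, φ', ψ)` and
`J(x, yφ, ψ') ≥ min_φ J(x, φ, ψ')`. -/
lemma PLIn_niFunction (h : BestResponses γ τφ τψ M cφ cψ rφ rψ yφ yψ) {Br Cr Lr δπ δρ : ℝ}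
    {Φ : Set (Param S A)} {Ψ : Set (Param S B)} (hγ0 : 0 < γ) (hγ1 : γ < 1) (hτφ : 0 < τφ)
    (hτψ : 0 < τψ) (hδπ : 0 < δπ) (hδρ : 0 < δρ) (hM : GameAssumption M Br Cr Lr δπ δρ Φ Ψ)
    (hL₁ : 0 ≤ L₁) (hL₂ : 0 ≤ L₂)
    (hJ : LipschitzDerivs L₁ L₂ (joint (objective γ τφ τψ M))) :
    PLIn (δρ ^ 2 * δπ ^ 2 * (1 - γ) * min τφ τψ / 2) Φ Ψ (niFunction γ τφ τψ M) := by
  have hγ' : 0 < 1 - γ := by linarith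
  set k := δρ ^ 2 * δπ ^ 2 * (1 - γ) with hk
  have hk0 : 0 < k := by positivity
  have hmin : 0 < min τφ τψ := lt_min hτφ hτψ
  -- Each player's inequality holds with the smaller constant too, also where its left-hand side is
  -- negative.
  have weaken : ∀ {τ X N : ℝ}, min τφ τψ ≤ τ → 0 ≤ N → k * τ * X ≤ N →
      k * min τφ τψ * X ≤ N := by
    intro τ X N hτ hN hX
    rcases le_total 0 X with h0 | h0
    · refine le_trans ?_ hX
      gcongr
    · have : k * min τφ τψ * X ≤ 0 := mul_nonpos_of_nonneg_of_nonpos (by positivity) h0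
      linarith
  intro x
  refine ⟨fun θ => (hasFDerivAt_inTheta
    (h.lipschitzDerivs_niFunction hL₁ hL₂ hJ).differentiable x θ).differentiableAt,
    ⟨0, by rintro _ ⟨θ, rfl⟩; exact h.niFunction_nonneg x _ _⟩, fun θ hφ hψ => ?_⟩
  set N := ‖gradient (inTheta (niFunction γ τφ τψ M) x) θ‖ ^ 2 with hN
  have hμ : 0 < k * min τφ τψ := by positivity
  have key : ∀ θ', inTheta (niFunction γ τφ τψ M) x θ - N / (k * min τφ τψ)
      ≤ inTheta (niFunction γ τφ τψ M) x θ' := by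
    intro θ'
    have h1 := weaken (min_le_left _ _) (sq_nonneg _)
      (objective_PL_min hγ0 hγ1 hτφ hδπ hδρ hM hJ.differentiable x hφ θ'.fst (yψ x θ.fst))
    have h2 := weaken (min_le_right _ _) (sq_nonneg _)
      (objective_PL_max hγ0 hγ1 hτψ hδπ hδρ hM hJ.differentiable x (yφ x θ.snd) hψ θ'.snd)
    have h3 := h.le_max x θ'.fst (yψ x θ.fst)
    have h4 := h.min_le x θ'.snd (yφ x θ.snd)
    have h5 := h.norm_gradient_niFunction_sq hL₁ hL₂ hJ x θ
    rw [sub_le_comm, le_div_iff₀' hμ, hN, h5]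
    refine le_trans ?_ (add_le_add h1 h2)
    rw [← mul_add]
    refine mul_le_mul_of_nonneg_left ?_ hμ.le
    simp only [inTheta, h.niFunction_eq]
    linarith
  have h6 := le_ciInf key
  rw [sub_le_comm, le_div_iff₀' hμ] at h6
  calc _ = k * min τφ τψ * (inTheta (niFunction γ τφ τψ M) x θ
        - ⨅ θ', inTheta (niFunction γ τφ τψ M) x θ') := by ring
    _ ≤ N := h6

end BestResponses

end NikaidoIsoda

end MarkovGame

open MarkovGame in
theorem lemma2 {S A B : Type*} [Fintype S] [Fintype A] [Fintype B] [Nonempty A] [Nonempty B]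
    (d : ℕ) (γ τφ τψ : ℝ) (hγ0 : 0 < γ) (hγ1 : γ < 1) (hτφ : 0 < τφ) (hτψ : 0 < τψ)
    (Br Cr Lr δπ δρ CJ LJ₁ LJ₂ : ℝ) (hδπ : 0 < δπ) (hδρ : 0 < δρ) :
    ∃ μg Cg Lg₁ Lg₂ : ℝ, 0 < μg ∧ 0 < Cg ∧ 0 < Lg₁ ∧ 0 < Lg₂ ∧
      ∀ (M : MarkovGame.Game d S A B)
        (Φ : Set (MarkovGame.Param S A)) (Ψ : Set (MarkovGame.Param S B)),
        MarkovGame.GameAssumption M Br Cr Lr δπ δρ Φ Ψ →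
        MarkovGame.FunctionAssumption (MarkovGame.objective γ τφ τψ M) CJ LJ₁ LJ₂ →
        MarkovGame.BestResponsesExist γ τφ τψ M ∧
        MarkovGame.PLIn μg Φ Ψ (MarkovGame.niFunction γ τφ τψ M) ∧
        MarkovGame.LipschitzIn Cg (MarkovGame.niFunction γ τφ τψ M) ∧
        MarkovGame.SmoothIn Lg₁ (MarkovGame.niFunction γ τφ τψ M) ∧
        MarkovGame.HessianLipschitzIn Lg₂ (MarkovGame.niFunction γ τφ τψ M) := by
  set L₁ := 3 * |LJ₁| with hL₁
  set L₂ := 3 * |LJ₂| with hL₂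
  set cφ := minModulus S A B γ τφ τψ Br δρ with hcφ
  set cψ := maxModulus S A B γ τφ τψ Br δρ with hcψ
  have hL₁0 : 0 ≤ L₁ := by positivity
  have hL₂0 : 0 ≤ L₂ := by positivity
  have hcφ0 : 0 < cφ := growthModulus_pos hτφ hδρ
  have hcψ0 : 0 < cψ := growthModulus_pos hτψ hδρ
  have hγ' : 0 < 1 - γ := by linarith
  have hmin : 0 < min τφ τψ := lt_min hτφ hτψ
  have hK₁ : 0 ≤ L₁ * (1 + L₁ / (2 * cψ)) + L₁ * (1 + L₁ / (2 * cφ)) := by positivity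
  have hK₂ : 0 ≤ L₂ * (1 + L₁ / (2 * cψ)) ^ 3 + L₂ * (1 + L₁ / (2 * cφ)) ^ 3 := by positivity
  -- The summands `1` only serve to make the constants positive.
  refine ⟨δρ ^ 2 * δπ ^ 2 * (1 - γ) * min τφ τψ / 2, 2 * (|CJ| + 1),
    L₁ * (1 + L₁ / (2 * cψ)) + L₁ * (1 + L₁ / (2 * cφ)) + 1,
    L₂ * (1 + L₁ / (2 * cψ)) ^ 3 + L₂ * (1 + L₁ / (2 * cφ)) ^ 3 + 1,
    by positivity, by positivity, by linarith, by linarith, fun M Φ Ψ hM hF => ?_⟩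
  have hJ := lipschitzDerivs_of_assumption hF
  obtain ⟨yφ, yψ, h⟩ := exists_bestResponses hγ0 hγ1 hτφ hτψ hδρ hM
  have hg := h.lipschitzDerivs_niFunction hL₁0 hL₂0 hJ
  refine ⟨h.bestResponsesExist,
    h.PLIn_niFunction hγ0 hγ1 hτφ hτψ hδπ hδρ hM hL₁0 hL₂0 hJ, fun z w => ?_,
    hg.smoothIn (by linarith) (by linarith), hg.hessianLipschitzIn (by linarith) (by linarith)⟩
  refine (h.lipschitzIn_niFunction hF.lipschitz z w).trans
    (mul_le_mul_of_nonneg_right (by linarith) (sumDist_nonneg z w))
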